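/- \textbf{Setting.} Let $\mathcal S,\mathcal A$ be finite nonempty sets, $\mathbb P(\cdot|s,a)$ transition probabilities on $\mathcal S$, $r:\mathcal S\times\mathcal A\to[0,1]$ a reward, $\gamma\in(0,1)$, $\mu$ a probability distribution on $\mathcal S$, $H\in\mathbb N$ and $\lambda>0$. For $\theta\in\mathbb R^{\mathcal S\times\mathcal A}$ let $\pi_\theta(a|s)=e^{\theta_{s,a}}/\sum_{a'}e^{\theta_{s,a'}}$ be the soft-max policy. For $\tau=(s_0,a_0,\dots,s_{H-1},a_{H-1},s_H)$ put $p(\tau|\theta,\mu)=\mu(s_0)\prod_{h=0}^{H-1}\pi_\theta(a_h|s_h)\mathbb P(s_{h+1}|s_h,a_h)$, and let $$J^H_\mu(\theta)=\mathbb E_{\tau\sim p(\cdot|\theta,\mu)}\Big[\sum_{h=0}^{H-1}\gamma^h r(s_h,a_h)\Big],\qquad L^H_{\lambda,\mu}(\theta)=J^H_\mu(\theta)+\frac{\lambda}{|\mathcal A||\mathcal S|}\sum_{s,a}\log\pi_\theta(a|s)+\lambda\log|\mathcal A| .$$ Let $g(\tau|\theta,\mu)=\sum_{h=0}^{H-1}\sum_{j=0}^{h}(\gamma^h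 r(s_h,a_h)-b_h)\nabla\log\pi_\theta(a_j|s_j)$ be the truncated GPOMDP estimator with constant baselines $b_h$ satisfying $|\gamma^h r(s,a)-b_h|\le\gamma^h$ for all $h<H$, $s$, $a$ (for instance $0\le b_h\le\gamma^h$), and let $w(\tau|\theta',\theta)=\prod_{h=0}^{H-1}\pi_{\theta'}(a_h|s_h)/\pi_\theta(a_h|s_h)$. \textbf{Algorithm (STORM-PG-S).} Given a number of iterations $T$, a batch size $B\ge1$, an initial point $\theta_1$ and parameters $k,m,c$, put $\eta_t=k/(m+t)^{1/3}$ and $\beta_{t+1}=c\eta_t^2$. For $t=1,\dots,T-1$: conditionally on the batches drawn before, draw i.i.d. trajectories $\tau_1,\dots,\tau_B$ from $p(\cdot|\theta_t,\mu)$; set $u^H_1=\frac1B\sum_i g(\tau_i|\theta_1,\mu)$ and, for $t\ge2$, $$u^H_t=\frac{\beta_t}{B}\sum_{i=1}^B g(\tau_i|\theta_t,\mu)+(1-\beta_t)\Big[u^H_{t-1}+\frac1B\sum_{i=1}^B\big(g(\tau_i|\theta_t,\mu)-w(\tau_i|\theta_{t-1},\theta_t)\,g(\tau_i|\theta_{t-1},\mu)\big)\Big];$$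 then set $\theta_{t+1}=\theta_t+\eta_t\big(u^H_t+\frac{\lambda}{|\mathcal A||\mathcal S|}\sum_{s,a}\nabla\log\pi_{\theta_t}(a|s)\big)$. \textbf{Lemma.} (i) For all $\theta,s,a$ one has $\|\nabla\log\pi_\theta(a|s)\|_2\le M_g$ and $\|\nabla^2\log\pi_\theta(a|s)\|_2\le M_h$ with $M_g=2$, $M_h=1$; and $L^H_{\lambda,\mu}$ attains its maximum. (ii) Let $M_g,M_h>0$ be any constants for which the two bounds in (i) hold for all $\theta,s,a$. Let $k>0$ and $W>0$, and put $$L_g=\tfrac{M_h}{(1-\gamma)^2},\quad \sigma=G=\tfrac{M_g}{(1-\gamma)^2},\quad L=\tfrac{2M_g^2}{(1-\gamma)^3}+\tfrac{M_h}{(1-\gamma)^2},\quad L_\lambda=L+\lambda,\quad C_w=\sqrt{H(2HM_g^2+M_h)(W+1)},$$ $$b^2=L_g^2+G^2C_w^2,\qquad c=\frac1{3k^3L_\lambda}+96b^2,\qquad m=\max\Big\{2,(2L_\lambda k)^3,\Big(\frac{ck}{2L_\lambda}\Big)^3\Big\}.$$ Let $\theta_1,\dots,\theta_T$ be generated by STORM-PG-S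 with these parameters, and suppose that almost surely $\mathrm{Var}_{\tau\sim p(\cdot|\theta_{t+1},\mu)}\big(w(\tau|\theta_t,\theta_{t+1})\big)\le W$ for all $1\le t\le T-1$. Let $\theta^*$ be a global maximizer of $L^H_{\lambda,\mu}$. Then the random variables $\eta_t\|\nabla L^H_{\lambda,\mu}(\theta_t)\|_2^2$, $1\le t\le T$, are integrable and $$\sum_{t=1}^T\mathbb E\big[\eta_t\|\nabla L^H_{\lambda,\mu}(\theta_t)\|_2^2\big]\le\Gamma_2+\frac{\Gamma_1+\Gamma_3}{B},$$ where, with $\Delta=L^H_{\lambda,\mu}(\theta^*)-L^H_{\lambda,\mu}(\theta_1)$, $$\Gamma_1=\frac{c^2\sigma^2k^3\ln(T+2)}{44b^2}+\frac{m^{1/3}\sigma^2}{88b^2k}+\frac{\Delta}{22},\qquad \Gamma_2=\frac{48}{11}\Delta,\qquad \Gamma_3=\frac{\sigma^2m^{1/3}}{44b^2k}+\frac{c^2\sigma^2k^3}{22b^2}\ln(2+T).$$ -/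

import Mathlib

open MeasureTheory

noncomputable section

namespace StormPG

/-- A finite discounted Markov decision process with rewards in `[0,1]` and discount in `(0,1)`. -/
structure FiniteMDP (S A : Type*) [Fintype S] where
  /-- `trans s a s'` is the probability of moving from `s` to `s'` under the action `a`. -/
  trans : S → A → S → ℝ
  trans_mem : ∀ s a, trans s a ∈ stdSimplex ℝ S
  reward : S → A → ℝ
  reward_mem : ∀ s a, reward s a ∈ Set.Icc (0 : ℝ) 1
  disc : ℝ
  disc_mem : disc ∈ Set.Ioo (0 : ℝ) 1

/-- The parameter space, with its Euclidean norm. -/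
abbrev Param (S A : Type*) := EuclideanSpace ℝ (S × A)

/-- Truncated trajectories `(s_0, …, s_H; a_0, …, a_{H-1})`. -/
abbrev Traj (S A : Type*) (H : ℕ) := (Fin (H + 1) → S) × (Fin H → A)

section Policy

variable {S A : Type*} [Fintype S] [Fintype A]

/-- The soft-max policy `π_θ(a|s)`. -/
def softmax (θ : Param S A) (s : S) (a : A) : ℝ :=
  Real.exp (θ (s, a)) / ∑ a' : A, Real.exp (θ (s, a'))

/-- The score `∇_θ log π_θ(a|s)`. -/
def score (s : S) (a : A) (θ : Param S A) : Param S A :=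
  gradient (fun θ' : Param S A => Real.log (softmax θ' s a)) θ

variable (S A) in
/-- The gradient and the Hessian of `θ ↦ log π_θ(a|s)` are bounded by `Mg` and `Mh`
in Euclidean norm and in the induced operator norm. -/
def ScoreBounds (Mg Mh : ℝ) : Prop :=
  ∀ (θ : Param S A) (s : S) (a : A),
    ‖score s a θ‖ ≤ Mg ∧ ‖fderiv ℝ (score s a) θ‖ ≤ Mh

/-- The probability `p(τ|θ,μ)` of a truncated trajectory. -/
def trajProb (M : FiniteMDP S A) (μ : S → ℝ) {H : ℕ} (θ : Param S A) (τ : Traj S A H) : ℝ :=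
  μ (τ.1 0) * ∏ h : Fin H,
    (softmax θ (τ.1 h.castSucc) (τ.2 h) * M.trans (τ.1 h.castSucc) (τ.2 h) (τ.1 h.succ))

/-- The truncated value function `J^H_μ(θ)`. -/
def truncValue (M : FiniteMDP S A) (μ : S → ℝ) (H : ℕ) (θ : Param S A) : ℝ :=
  ∑ τ : Traj S A H, trajProb M μ θ τ *
    ∑ h : Fin H, M.disc ^ (h : ℕ) * M.reward (τ.1 h.castSucc) (τ.2 h)

/-- The truncated value function with log-barrier regularization, `L^H_{λ,μ}(θ)`. -/
def regValue (M : FiniteMDP S A) (μ : S → ℝ) (H : ℕ) (lam : ℝ) (θ : Param S A) : ℝ :=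
  truncValue M μ H θ
    + lam / ((Fintype.card A : ℝ) * Fintype.card S)
        * ∑ s : S, ∑ a : A, Real.log (softmax θ s a)
    + lam * Real.log (Fintype.card A)

/-- The truncated GPOMDP estimator `g(τ|θ,μ)` with baselines `base h`. -/
def gpomdp (M : FiniteMDP S A) (base : ℕ → ℝ) {H : ℕ} (θ : Param S A) (τ : Traj S A H) :
    Param S A :=
  ∑ h : Fin H, ∑ j ∈ Finset.Iic h,
    (M.disc ^ (h : ℕ) * M.reward (τ.1 h.castSucc) (τ.2 h) - base h) •
      score (τ.1 j.castSucc) (τ.2 j) θ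

/-- The importance sampling weight `w(τ|θ',θ)`. -/
def impWeight {H : ℕ} (θ' θ : Param S A) (τ : Traj S A H) : ℝ :=
  ∏ h : Fin H, softmax θ' (τ.1 h.castSucc) (τ.2 h) / softmax θ (τ.1 h.castSucc) (τ.2 h)

/-- The variance of `w(τ|θ',θ)` for `τ` drawn from `p(·|θ,μ)`. -/
def impWeightVar (M : FiniteMDP S A) (μ : S → ℝ) (H : ℕ) (θ' θ : Param S A) : ℝ :=
  ∑ τ : Traj S A H, trajProb M μ θ τ *
    (impWeight θ' θ τ - ∑ τ' : Traj S A H, trajProb M μ θ τ' * impWeight θ' θ τ') ^ 2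

/-- The gradient of the log-barrier term at `θ`. -/
def barrierGrad (lam : ℝ) (θ : Param S A) : Param S A :=
  (lam / ((Fintype.card A : ℝ) * Fintype.card S)) • ∑ s : S, ∑ a : A, score s a θ

/-- `τ`, `u`, `θ` are the random batches of trajectories, gradient estimators and iterates of a run
of the momentum-based policy gradient method (STORM-PG-S) on the probability space `(Ω, P)`, with
step sizes `η t`, momentum parameters `β t` and initial point `θ₁`.  Times run from `1` as in the
loop `t = 1, …, T - 1`, which produces `θ 1, …, θ T`. -/
structure IsStormRun {Ω : Type*} [MeasurableSpace Ω] (P : Measure Ω)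
    (M : FiniteMDP S A) (μ : S → ℝ) (H B T : ℕ) (base : ℕ → ℝ) (lam : ℝ) (η β : ℕ → ℝ)
    (θ₁ : Param S A) (τ : ℕ → Ω → Fin B → Traj S A H) (u θ : ℕ → Ω → Param S A) : Prop where
  measurable_batch : ∀ t, 1 ≤ t → t < T → ∀ y, MeasurableSet {ω | τ t ω = y}
  /-- Given the batches drawn before time `t`, the `B` trajectories of time `t` are independent
  with common law `p(·|θ_t,μ)`. -/
  law_batch : ∀ t, 1 ≤ t → t < T → ∀ (ω₀ : Ω) (y : Fin B → Traj S A H),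
    P {ω | (∀ t', 1 ≤ t' → t' < t → τ t' ω = τ t' ω₀) ∧ τ t ω = y} =
      P {ω | ∀ t', 1 ≤ t' → t' < t → τ t' ω = τ t' ω₀} *
        ENNReal.ofReal (∏ i : Fin B, trajProb M μ (θ t ω₀) (y i))
  init : ∀ ω, θ 1 ω = θ₁
  est_one : 1 < T → ∀ ω, u 1 ω = (1 / (B : ℝ)) • ∑ i : Fin B, gpomdp M base (θ 1 ω) (τ 1 ω i)
  est_succ : ∀ t, 1 ≤ t → t + 1 < T → ∀ ω,
    u (t + 1) ω =
      (β (t + 1) / (B : ℝ)) • ∑ i : Fin B, gpomdp M base (θ (t + 1) ω) (τ (t + 1) ω i)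
      + (1 - β (t + 1)) • (u t ω + (1 / (B : ℝ)) • ∑ i : Fin B,
          (gpomdp M base (θ (t + 1) ω) (τ (t + 1) ω i)
            - impWeight (θ t ω) (θ (t + 1) ω) (τ (t + 1) ω i) •
                gpomdp M base (θ t ω) (τ (t + 1) ω i)))
  step : ∀ t, 1 ≤ t → t < T → ∀ ω,
    θ (t + 1) ω = θ t ω + η t • (u t ω + barrierGrad lam (θ t ω))

end Policy

end StormPG

end

open StormPG

open StormPG

set_option linter.unusedSectionVars false

namespace StormPG

open scoped RealInnerProductSpace

/-! ### Calculus of the soft-max policy: closed form of the score, its norm and its derivative. -/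

section SoftmaxCalculus

variable {S A : Type*} [Fintype S] [Fintype A]

/-! The argument is a stochastic ascent analysis with a variance-reduced gradient estimator. Write
`E t` for the mean squared error of `u t` against the gradient of the truncated value, `D t` for the
mean square of the update direction, and `N t` for the mean squared norm of the full gradient. Since
the objective is `Llam`-smooth and `η t ≤ 1 / (2 * Llam)`, one step raises the mean objective by at
least `η/2 * N - η/2 * E + η/4 * D` (`ScoreBounds.regValue_step_lower`). It remains to pay for the
errors `E` with the surplus `D`.

Conditionally on the past, the new error is the old one shrunk by `1 - β` plus an average of `B`
independent centred terms (`ScoreBounds.batch_error_succ_le`). The fresh noise has size `β ^ 2 * σ ^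
2 / B`, and the correction term has size `b ^ 2 * ‖θ (t + 1) - θ t‖ ^ 2 / B`, that is `b ^ 2 * η ^ 2
* D / B`. The last point needs the variance of the importance weights to be quadratic in the
parameter distance (`ScoreBounds.impWeightVar_le`): along the segment between the two parameters,
the second moment `f` of the weight satisfies `f'' ≤ 2 q f` with `q` quadratic in the distance, and
`f` starts at `1` with slope `0`.

The potential `E t / η (t - 1)` then decreases: `c` is tuned so that the contraction beats the
growth of `1 / η` and still leaves `96 * b ^ 2 * η t * E t` to sum (`sum_error_le`). This bounds the
sum of `η * E` by a term of order `1 / B` plus `1/24` of the sum of `η * D`, which the ascent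
surplus absorbs (`sum_gradient_le`). The noise adds up to the sum of `η ^ 3`, which is logarithmic
because `η ^ 3` is harmonic.

Existence of a maximizer follows from compactness once parameters are replaced by their
log-probabilities, which the log-barrier keeps bounded. -/

theorem sum_exp_pos [Nonempty A] (θ : Param S A) (s : S) :
    0 < ∑ a' : A, Real.exp (θ (s, a')) :=
  Finset.sum_pos (fun _ _ => Real.exp_pos _) Finset.univ_nonempty

theorem softmax_pos (θ : Param S A) (s : S) (a : A) : 0 < softmax θ s a :=
  have : Nonempty A := ⟨a⟩
  div_pos (Real.exp_pos _) (sum_exp_pos θ s)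

theorem sum_softmax [Nonempty A] (θ : Param S A) (s : S) : ∑ a, softmax θ s a = 1 := by
  unfold softmax
  rw [← Finset.sum_div, div_self (sum_exp_pos θ s).ne']

theorem softmax_le_one (θ : Param S A) (s : S) (a : A) : softmax θ s a ≤ 1 := by
  have : Nonempty A := ⟨a⟩
  rw [← sum_softmax θ s]
  exact Finset.single_le_sum (fun b _ => (softmax_pos θ s b).le) (Finset.mem_univ a)

theorem log_softmax (θ : Param S A) (s : S) (a : A) :
    Real.log (softmax θ s a) = θ (s, a) - Real.log (∑ a' : A, Real.exp (θ (s, a'))) := by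
  have : Nonempty A := ⟨a⟩
  rw [softmax, Real.log_div (Real.exp_pos _).ne' (sum_exp_pos θ s).ne', Real.log_exp]

theorem hasFDerivAt_coord (i : S × A) (θ : Param S A) :
    HasFDerivAt (fun θ' : Param S A => θ' i) (EuclideanSpace.proj (𝕜 := ℝ) i) θ :=
  (EuclideanSpace.proj (𝕜 := ℝ) i).hasFDerivAt

open Classical in
/-- The closed form of the score of the soft-max policy. -/
noncomputable def softmaxScore (s : S) (a : A) (θ : Param S A) : Param S A :=
  EuclideanSpace.single (s, a) 1 - ∑ a', softmax θ s a' • EuclideanSpace.single (s, a') 1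

theorem hasGradientAt_log_softmax' (θ : Param S A) (s : S) (a : A) :
    HasGradientAt (fun θ' : Param S A => Real.log (softmax θ' s a)) (softmaxScore s a θ) θ := by
  classical
  have : Nonempty A := ⟨a⟩
  have h1 : HasFDerivAt (fun θ' : Param S A => ∑ a' : A, Real.exp (θ' (s, a')))
      (∑ a' : A, Real.exp (θ (s, a')) • EuclideanSpace.proj (𝕜 := ℝ) (s, a')) θ :=
    HasFDerivAt.fun_sum fun a' _ => (hasFDerivAt_coord (s, a') θ).exp
  have h2 := (hasFDerivAt_coord (s, a) θ).sub (h1.log (sum_exp_pos θ s).ne')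
  rw [hasGradientAt_iff_hasFDerivAt]
  simp_rw [log_softmax]
  refine h2.congr_fderiv ?_
  ext v
  simp [softmaxScore, softmax,
    EuclideanSpace.inner_single_left, Finset.mul_sum, div_eq_inv_mul, mul_assoc]

theorem score_eq (s : S) (a : A) : score (S := S) s a = softmaxScore s a :=
  funext fun θ => (hasGradientAt_log_softmax' θ s a).gradient

theorem hasGradientAt_log_softmax (θ : Param S A) (s : S) (a : A) :
    HasGradientAt (fun θ' : Param S A => Real.log (softmax θ' s a)) (score s a θ) θ := by
  rw [score_eq]; exact hasGradientAt_log_softmax' θ s a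

theorem hasFDerivAt_softmax (θ : Param S A) (s : S) (a : A) :
    HasFDerivAt (fun θ' : Param S A => softmax θ' s a)
      (softmax θ s a • InnerProductSpace.toDual ℝ _ (softmaxScore s a θ)) θ := by
  have h := (hasGradientAt_log_softmax' θ s a).hasFDerivAt.exp
  simp only [Real.exp_log (softmax_pos _ s a)] at h
  exact h

open Classical in
theorem hasFDerivAt_score (θ : Param S A) (s : S) (a : A) :
    HasFDerivAt (score (S := S) s a)
      (-∑ a', (softmax θ s a' • InnerProductSpace.toDual ℝ (Param S A)
        (softmaxScore s a' θ)).smulRight (EuclideanSpace.single (s, a') (1 : ℝ))) θ := by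
  rw [score_eq]
  unfold softmaxScore
  refine (HasFDerivAt.fun_sum fun a' _ => ?_).const_sub _
  exact (hasFDerivAt_softmax θ s a').smul_const _

theorem differentiable_score (s : S) (a : A) : Differentiable ℝ (score (S := S) s a) :=
  fun θ => (hasFDerivAt_score θ s a).differentiableAt

theorem softmaxScore_inner (θ v : Param S A) (s : S) (a : A) :
    ⟪softmaxScore s a θ, v⟫ = v (s, a) - ∑ a', softmax θ s a' * v (s, a') := by
  classical
  simp [softmaxScore, inner_sub_left, sum_inner, inner_smul_left,
    EuclideanSpace.inner_single_left]

theorem norm_score_le (θ : Param S A) (s : S) (a : A) : ‖score s a θ‖ ≤ 2 := by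
  classical
  have : Nonempty A := ⟨a⟩
  rw [score_eq, softmaxScore]
  refine (norm_sub_le _ _).trans ?_
  have h : ‖∑ a', softmax θ s a' • EuclideanSpace.single (s, a') (1 : ℝ)‖ ≤ 1 := by
    refine (norm_sum_le _ _).trans ?_
    refine (Finset.sum_le_sum fun b _ => ?_).trans_eq (sum_softmax θ s)
    rw [norm_smul, PiLp.norm_single, norm_one, mul_one,
      Real.norm_of_nonneg (softmax_pos θ s b).le]
  have h' : ‖EuclideanSpace.single (s, a) (1 : ℝ)‖ = 1 := by simp
  linarith

/-- Applied to `v`, the derivative has coordinates `-π(a') (v(s,a') - m)` in the row of `s`, where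
`m` is the policy mean of `v(s,·)`. Since `π ^ 2 ≤ π`, the squared norm is at most the variance of
`v(s,·)` under the policy, hence at most its second moment, hence at most `‖v‖ ^ 2`. -/
theorem norm_fderiv_score_le (θ : Param S A) (s : S) (a : A) :
    ‖fderiv ℝ (score (S := S) s a) θ‖ ≤ 1 := by
  classical
  have : Nonempty A := ⟨a⟩
  rw [(hasFDerivAt_score θ s a).fderiv]
  refine ContinuousLinearMap.opNorm_le_bound _ zero_le_one fun v => ?_
  rw [one_mul]
  refine le_of_sq_le_sq ?_ (norm_nonneg _)
  set m := ∑ a', softmax θ s a' * v (s, a') with hm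
  have hcoord : ∀ i : S × A, (∑ a', (softmax θ s a' * (v (s, a') - m)) •
      EuclideanSpace.single (s, a') (1 : ℝ) : Param S A) i =
      if i.1 = s then softmax θ s i.2 * (v (s, i.2) - m) else 0 := by
    rintro ⟨s', a'⟩
    by_cases h : s' = s
    · subst h
      simp [Pi.single_apply]
    · simp [h]
  have e : (-∑ a', (softmax θ s a' • InnerProductSpace.toDual ℝ (Param S A)
        (softmaxScore s a' θ)).smulRight (EuclideanSpace.single (s, a') (1 : ℝ))) v =
      -(∑ a', (softmax θ s a' * (v (s, a') - m)) •
      EuclideanSpace.single (s, a') (1 : ℝ) : Param S A) := by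
    simp only [neg_apply, sum_apply,
      ContinuousLinearMap.smulRight_apply, smul_apply,
      InnerProductSpace.toDual_apply_apply, softmaxScore_inner, smul_eq_mul, hm]
  rw [e, norm_neg, EuclideanSpace.norm_sq_eq, EuclideanSpace.norm_sq_eq]
  simp_rw [hcoord]
  rw [Fintype.sum_prod_type, Fintype.sum_prod_type]
  have h1 : ∑ x : S, ∑ y : A, ‖if x = s then softmax θ s y * (v (s, y) - m) else 0‖ ^ 2 =
      ∑ y, (softmax θ s y * (v (s, y) - m)) ^ 2 := by
    rw [Finset.sum_eq_single s]
    · simp [mul_pow]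
    · intro b _ hb
      simp [hb]
    · simp
  rw [h1]
  have h2 : ∑ y, (softmax θ s y * (v (s, y) - m)) ^ 2 ≤
      ∑ y, softmax θ s y * (v (s, y) - m) ^ 2 := by
    refine Finset.sum_le_sum fun y _ => ?_
    have := softmax_pos θ s y
    have := softmax_le_one θ s y
    rw [mul_pow]
    exact mul_le_mul_of_nonneg_right (by nlinarith) (sq_nonneg _)
  have h3 : ∑ y, softmax θ s y * (v (s, y) - m) ^ 2 =
      ∑ y, softmax θ s y * v (s, y) ^ 2 - m ^ 2 := by
    have : ∀ y, softmax θ s y * (v (s, y) - m) ^ 2 = softmax θ s y * v (s, y) ^ 2 -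
      2 * m * (softmax θ s y * v (s, y)) + m ^ 2 * softmax θ s y := fun y => by ring
    simp_rw [this]
    rw [Finset.sum_add_distrib, Finset.sum_sub_distrib, ← Finset.mul_sum, ← Finset.mul_sum,
      sum_softmax, ← hm]
    ring
  have h4 : ∑ y, softmax θ s y * v (s, y) ^ 2 ≤ ∑ y, ‖v (s, y)‖ ^ 2 := by
    refine Finset.sum_le_sum fun y _ => ?_
    rw [Real.norm_eq_abs, sq_abs]
    exact mul_le_of_le_one_left (sq_nonneg _) (softmax_le_one θ s y)
  have h5 : ∑ y, ‖v (s, y)‖ ^ 2 ≤ ∑ x : S, ∑ y : A, ‖v (x, y)‖ ^ 2 :=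
    Finset.single_le_sum (f := fun x : S => ∑ y : A, ‖v (x, y)‖ ^ 2)
      (fun x _ => Finset.sum_nonneg fun y _ => sq_nonneg _) (Finset.mem_univ s)
  nlinarith [sq_nonneg m]

variable (S A) in
theorem scoreBounds_two_one : ScoreBounds S A 2 1 :=
  fun θ s a => ⟨norm_score_le θ s a, norm_fderiv_score_le θ s a⟩

theorem ScoreBounds.norm_score_sub_le {Mg Mh : ℝ} (hb : ScoreBounds S A Mg Mh)
    (s : S) (a : A) (θ θ' : Param S A) :
    ‖score s a θ' - score s a θ‖ ≤ Mh * ‖θ' - θ‖ :=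
  convex_univ.norm_image_sub_le_of_norm_fderiv_le
    (fun x _ => (differentiable_score s a x)) (fun x _ => (hb x s a).2)
    (Set.mem_univ θ) (Set.mem_univ θ')

theorem HasGradientAt.hasDerivAt_line {E : Type*} [NormedAddCommGroup E] [InnerProductSpace ℝ E]
    [CompleteSpace E] {f : E → ℝ} {g θ v : E} {x : ℝ} (h : HasGradientAt f g (θ + x • v)) :
    HasDerivAt (fun y : ℝ => f (θ + y • v)) ⟪g, v⟫ x := by
  have h1 : HasDerivAt (fun y : ℝ => θ + y • v) v x := by
    simpa using ((hasDerivAt_id x).smul_const v).const_add θ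
  exact (h.hasFDerivAt.comp_hasDerivAt x h1).congr_deriv (by simp)

theorem HasFDerivAt.hasDerivAt_inner_line {E : Type*} [NormedAddCommGroup E]
    [InnerProductSpace ℝ E] {g : E → E} {g' : E →L[ℝ] E} {θ v : E} {x : ℝ}
    (h : HasFDerivAt g g' (θ + x • v)) :
    HasDerivAt (fun y : ℝ => ⟪g (θ + y • v), v⟫) ⟪g' v, v⟫ x := by
  have h1 : HasDerivAt (fun y : ℝ => θ + y • v) v x := by
    simpa using ((hasDerivAt_id x).smul_const v).const_add θ
  simpa using (h.comp_hasDerivAt x h1).inner ℝ (hasDerivAt_const x v)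

end SoftmaxCalculus

/-- Second order Taylor upper bound on `[0, 1]`. -/
theorem le_quadratic_of_deriv_deriv_le {f f' f'' : ℝ → ℝ} {C : ℝ}
    (hf : ∀ x, HasDerivAt f (f' x) x) (hf' : ∀ x, HasDerivAt f' (f'' x) x)
    (hC : ∀ x ∈ Set.Icc (0 : ℝ) 1, f'' x ≤ C) {x : ℝ} (hx : x ∈ Set.Icc (0 : ℝ) 1) :
    f x ≤ f 0 + f' 0 * x + C / 2 * x ^ 2 := by
  have key : ∀ (g g' : ℝ → ℝ), (∀ y, HasDerivAt g (g' y) y) →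
      (∀ y ∈ Set.Icc (0 : ℝ) 1, g' y ≤ 0) → ∀ y ∈ Set.Icc (0 : ℝ) 1, g y ≤ g 0 := by
    intro g g' hg hg' y hy
    have := antitoneOn_of_deriv_nonpos (convex_Icc (0 : ℝ) 1)
      (fun z _ => (hg z).continuousAt.continuousWithinAt)
      (fun z _ => (hg z).differentiableAt.differentiableWithinAt)
      (fun z hz => by rw [(hg z).deriv]; exact hg' z (interior_subset hz))
    exact this (Set.left_mem_Icc.2 zero_le_one) hy hy.1
  have h1 : ∀ y ∈ Set.Icc (0 : ℝ) 1, f' y - C * y ≤ 0 + f' 0 := by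
    intro y hy
    have := key (fun y => f' y - C * y) (fun y => f'' y - C)
      (fun y => ((hf' y).fun_sub ((hasDerivAt_id' y).const_mul C)).congr_deriv (by simp))
      (fun y hy => by linarith [hC y hy]) y hy
    simpa using this
  have := key (fun y => f y - f' 0 * y - C / 2 * y ^ 2) (fun y => f' y - f' 0 - C * y)
    (fun y => by
      have := ((hf y).fun_sub ((hasDerivAt_id' y).const_mul (f' 0))).fun_sub
        (((hasDerivAt_id' y).fun_pow 2).const_mul (C / 2))
      refine this.congr_deriv ?_
      simp
      ring)
    (fun y hy => by linarith [h1 y hy]) x hx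
  simp at this
  linarith

/-! ### Trajectory laws: marginals, likelihoods, and derivatives along lines. -/

section Trajectories

variable {S A : Type*} [Fintype S] [Fintype A]

/-- The first `n` steps of a trajectory. -/
def Traj.take {n H : ℕ} (h : n ≤ H) (τ : Traj S A H) : Traj S A n :=
  (fun i => τ.1 (Fin.castLE (Nat.succ_le_succ h) i), fun i => τ.2 (Fin.castLE h i))

/-- Trajectories of length `H + 1` are trajectories of length `H` with one more step. -/
def Traj.snocEquiv (S A : Type*) (H : ℕ) : Traj S A H × A × S ≃ Traj S A (H + 1) where
  toFun x := (Fin.snoc (α := fun _ => S) x.1.1 x.2.2, Fin.snoc (α := fun _ => A) x.1.2 x.2.1)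
  invFun τ := ((Fin.init τ.1, Fin.init τ.2), τ.2 (Fin.last H), τ.1 (Fin.last (H + 1)))
  left_inv x := by simp
  right_inv τ := by simp

theorem FiniteMDP.sum_trans (M : FiniteMDP S A) (s : S) (a : A) : ∑ s', M.trans s a s' = 1 :=
  (M.trans_mem s a).2

theorem FiniteMDP.trans_nonneg (M : FiniteMDP S A) (s : S) (a : A) (s' : S) :
    0 ≤ M.trans s a s' :=
  (M.trans_mem s a).1 s'

theorem trajProb_nonneg (M : FiniteMDP S A) {μ : S → ℝ} (hμ : μ ∈ stdSimplex ℝ S) {H : ℕ}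
    (θ : Param S A) (τ : Traj S A H) : 0 ≤ trajProb M μ θ τ :=
  mul_nonneg (hμ.1 _) (Finset.prod_nonneg fun _ _ =>
    mul_nonneg (softmax_pos _ _ _).le (M.trans_nonneg _ _ _))

theorem trajProb_snoc (M : FiniteMDP S A) (μ : S → ℝ) {H : ℕ} (θ : Param S A)
    (τ : Traj S A H) (a : A) (s : S) :
    trajProb M μ θ (Traj.snocEquiv S A H (τ, a, s)) =
      trajProb M μ θ τ * (softmax θ (τ.1 (Fin.last H)) a * M.trans (τ.1 (Fin.last H)) a s) := by
  unfold trajProb Traj.snocEquiv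
  simp only [Equiv.coe_fn_mk]
  rw [Fin.prod_univ_castSucc]
  have h0 : (Fin.snoc (α := fun _ => S) τ.1 s : Fin (H + 2) → S) 0 = τ.1 0 := by
    rw [← Fin.castSucc_zero, Fin.snoc_castSucc]
  simp only [h0, Fin.snoc_castSucc, Fin.succ_castSucc, Fin.snoc_last, Fin.succ_last]
  ring

theorem Traj.take_snoc {n H : ℕ} (h : n ≤ H) (τ : Traj S A H) (a : A) (s : S) :
    Traj.take (h.trans H.le_succ) (Traj.snocEquiv S A H (τ, a, s)) = Traj.take h τ := by
  unfold Traj.take Traj.snocEquiv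
  simp only [Equiv.coe_fn_mk, Prod.mk.injEq]
  constructor <;> funext i
  · exact Fin.snoc_castSucc (α := fun _ => S) s τ.1 (Fin.castLE (Nat.succ_le_succ h) i)
  · exact Fin.snoc_castSucc (α := fun _ => A) a τ.2 (Fin.castLE h i)

/-- Each step after time `n` contributes a conditional law of total mass one, so peeling off the
last step does not change the sum. This lets every reward term be studied on trajectories that stop
right after it, which makes the later bounds independent of `H`. -/
theorem sum_trajProb_smul_take [Nonempty A] {E : Type*} [AddCommGroup E] [Module ℝ E]
    (M : FiniteMDP S A) (μ : S → ℝ) (θ : Param S A) {n H : ℕ} (h : n ≤ H)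
    (f : Traj S A n → E) :
    ∑ τ : Traj S A H, trajProb M μ θ τ • f (τ.take h) =
      ∑ τ : Traj S A n, trajProb M μ θ τ • f τ := by
  induction H, h using Nat.le_induction with
  | base => rfl
  | succ H h ih =>
    rw [← ih, ← (Traj.snocEquiv S A H).sum_comp, Fintype.sum_prod_type]
    refine Finset.sum_congr rfl fun τ _ => ?_
    have hx : ∀ x : A × S, trajProb M μ θ (Traj.snocEquiv S A H (τ, x)) •
        f (Traj.take (h.trans H.le_succ) (Traj.snocEquiv S A H (τ, x))) =
        (softmax θ (τ.1 (Fin.last H)) x.1 * M.trans (τ.1 (Fin.last H)) x.1 x.2) •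
          (trajProb M μ θ τ • f (τ.take h)) := by
      rintro ⟨a, s⟩
      rw [trajProb_snoc, Traj.take_snoc h, smul_smul, mul_comm]
    rw [Finset.sum_congr rfl fun x _ => hx x, ← Finset.sum_smul, Fintype.sum_prod_type]
    simp_rw [← Finset.mul_sum, M.sum_trans, mul_one, sum_softmax, one_smul]

theorem sum_trajProb [Nonempty A] (M : FiniteMDP S A) {μ : S → ℝ} (hμ : μ ∈ stdSimplex ℝ S)
    (H : ℕ) (θ : Param S A) : ∑ τ : Traj S A H, trajProb M μ θ τ = 1 := by
  have h := sum_trajProb_smul_take M μ θ (Nat.zero_le H) (fun _ => (1 : ℝ))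
  simp only [smul_eq_mul, mul_one] at h
  rw [h, Fintype.sum_prod_type, ← hμ.2, ← (Equiv.funUnique (Fin 1) S).sum_comp]
  simp [trajProb]

/-- The log-likelihood of the actions along a trajectory. -/
noncomputable def logLik {H : ℕ} (θ : Param S A) (τ : Traj S A H) : ℝ :=
  ∑ h : Fin H, Real.log (softmax θ (τ.1 h.castSucc) (τ.2 h))

/-- The gradient of the log-likelihood of a trajectory. -/
noncomputable def trajScore {H : ℕ} (τ : Traj S A H) (θ : Param S A) : Param S A :=
  ∑ h : Fin H, score (τ.1 h.castSucc) (τ.2 h) θ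

/-- The factor of the trajectory probability that does not depend on the policy. -/
def trajBase (M : FiniteMDP S A) (μ : S → ℝ) {H : ℕ} (τ : Traj S A H) : ℝ :=
  μ (τ.1 0) * ∏ h : Fin H, M.trans (τ.1 h.castSucc) (τ.2 h) (τ.1 h.succ)

theorem exp_logLik {H : ℕ} (θ : Param S A) (τ : Traj S A H) :
    Real.exp (logLik θ τ) = ∏ h : Fin H, softmax θ (τ.1 h.castSucc) (τ.2 h) := by
  rw [logLik, Real.exp_sum]
  exact Finset.prod_congr rfl fun h _ => Real.exp_log (softmax_pos _ _ _)

theorem trajProb_eq (M : FiniteMDP S A) (μ : S → ℝ) {H : ℕ} (θ : Param S A) (τ : Traj S A H) :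
    trajProb M μ θ τ = trajBase M μ τ * Real.exp (logLik θ τ) := by
  rw [exp_logLik, trajProb, trajBase, Finset.prod_mul_distrib]
  ring

theorem impWeight_eq {H : ℕ} (θ' θ : Param S A) (τ : Traj S A H) :
    impWeight θ' θ τ = Real.exp (logLik θ' τ - logLik θ τ) := by
  rw [Real.exp_sub, exp_logLik, exp_logLik, impWeight, Finset.prod_div_distrib]

/-- Change of measure: the initial law and the transitions cancel in the likelihood ratio.
Reweighted estimators are therefore unbiased for the gradient at the old parameter. -/
theorem trajProb_mul_impWeight (M : FiniteMDP S A) (μ : S → ℝ) {H : ℕ} (θ' θ : Param S A)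
    (τ : Traj S A H) : trajProb M μ θ τ * impWeight θ' θ τ = trajProb M μ θ' τ := by
  rw [impWeight_eq, trajProb_eq, trajProb_eq, mul_assoc, ← Real.exp_add]
  congr 2
  ring

theorem hasGradientAt_sum {E ι : Type*} [NormedAddCommGroup E] [InnerProductSpace ℝ E]
    [CompleteSpace E] {f : ι → E → ℝ} {g : ι → E} {x : E} (s : Finset ι)
    (h : ∀ i ∈ s, HasGradientAt (f i) (g i) x) :
    HasGradientAt (fun y => ∑ i ∈ s, f i y) (∑ i ∈ s, g i) x := by
  rw [hasGradientAt_iff_hasFDerivAt, map_sum]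
  exact HasFDerivAt.fun_sum fun i hi => (h i hi).hasFDerivAt

theorem hasGradientAt_const_mul {E : Type*} [NormedAddCommGroup E] [InnerProductSpace ℝ E]
    [CompleteSpace E] {f : E → ℝ} {g : E} {x : E} (c : ℝ) (h : HasGradientAt f g x) :
    HasGradientAt (fun y => c * f y) (c • g) x := by
  rw [hasGradientAt_iff_hasFDerivAt, map_smulₛₗ]
  exact h.hasFDerivAt.const_mul c

theorem hasGradientAt_logLik {H : ℕ} (θ : Param S A) (τ : Traj S A H) :
    HasGradientAt (fun θ' => logLik θ' τ) (trajScore τ θ) θ :=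
  hasGradientAt_sum _ fun _ _ => hasGradientAt_log_softmax _ _ _

theorem hasGradientAt_trajProb (M : FiniteMDP S A) (μ : S → ℝ) {H : ℕ} (θ : Param S A)
    (τ : Traj S A H) :
    HasGradientAt (fun θ' => trajProb M μ θ' τ) (trajProb M μ θ τ • trajScore τ θ) θ := by
  simp_rw [trajProb_eq]
  rw [mul_smul]
  refine hasGradientAt_const_mul _ ?_
  rw [hasGradientAt_iff_hasFDerivAt, map_smulₛₗ]
  exact (hasGradientAt_logLik θ τ).hasFDerivAt.exp

theorem hasGradientAt_sum_trajProb (M : FiniteMDP S A) (μ : S → ℝ) {H : ℕ}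
    (f : Traj S A H → ℝ) (θ : Param S A) :
    HasGradientAt (fun θ' => ∑ τ : Traj S A H, f τ * trajProb M μ θ' τ)
      (∑ τ : Traj S A H, f τ • trajProb M μ θ τ • trajScore τ θ) θ :=
  hasGradientAt_sum _ fun τ _ => hasGradientAt_const_mul _ (hasGradientAt_trajProb M μ θ τ)

/-- The total mass is constantly one; differentiating it gives the claim. This is what makes
constant baselines harmless. -/
theorem sum_trajProb_smul_trajScore [Nonempty A] (M : FiniteMDP S A) {μ : S → ℝ}
    (hμ : μ ∈ stdSimplex ℝ S) {H : ℕ} (θ : Param S A) :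
    ∑ τ : Traj S A H, trajProb M μ θ τ • trajScore τ θ = 0 := by
  have h := hasGradientAt_sum_trajProb M μ (H := H) (fun _ => 1) θ
  simp only [one_mul, one_smul, sum_trajProb M hμ] at h
  exact h.unique (hasGradientAt_const θ 1)

theorem ScoreBounds.norm_trajScore_le {Mg Mh : ℝ} (hb : ScoreBounds S A Mg Mh) {H : ℕ}
    (τ : Traj S A H) (θ : Param S A) : ‖trajScore τ θ‖ ≤ H * Mg := by
  refine (norm_sum_le_of_le _ fun h _ => (hb θ _ _).1).trans ?_
  simp

theorem differentiable_trajScore {H : ℕ} (τ : Traj S A H) :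
    Differentiable ℝ (trajScore (S := S) (A := A) τ) :=
  Differentiable.fun_sum fun _ _ => differentiable_score _ _

theorem ScoreBounds.norm_fderiv_trajScore_le {Mg Mh : ℝ} (hb : ScoreBounds S A Mg Mh) {H : ℕ}
    (τ : Traj S A H) (θ : Param S A) : ‖fderiv ℝ (trajScore τ) θ‖ ≤ H * Mh := by
  have : fderiv ℝ (trajScore τ) θ =
      ∑ h : Fin H, fderiv ℝ (score (τ.1 h.castSucc) (τ.2 h)) θ :=
    fderiv_fun_sum fun h _ => differentiable_score _ _ θ
  rw [this]
  refine (norm_sum_le_of_le _ fun h _ => (hb θ _ _).2).trans ?_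
  simp

theorem hasDerivAt_logLik_line {H : ℕ} (τ : Traj S A H) (θ v : Param S A) (x : ℝ) :
    HasDerivAt (fun y : ℝ => logLik (θ + y • v) τ) ⟪trajScore τ (θ + x • v), v⟫ x :=
  HasGradientAt.hasDerivAt_line (hasGradientAt_logLik (θ + x • v) τ)

theorem hasDerivAt_trajScore_line {H : ℕ} (τ : Traj S A H) (θ v : Param S A) (x : ℝ) :
    HasDerivAt (fun y : ℝ => ⟪trajScore τ (θ + y • v), v⟫)
      ⟪fderiv ℝ (trajScore τ) (θ + x • v) v, v⟫ x :=
  HasFDerivAt.hasDerivAt_inner_line (differentiable_trajScore τ (θ + x • v)).hasFDerivAt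

/-- The derivative of `exp (κ * logLik)` along a line. -/
theorem hasDerivAt_exp_logLik_line {H : ℕ} (κ : ℝ) (τ : Traj S A H) (θ v : Param S A) (x : ℝ) :
    HasDerivAt (fun y : ℝ => Real.exp (κ * logLik (θ + y • v) τ))
      (Real.exp (κ * logLik (θ + x • v) τ) * (κ * ⟪trajScore τ (θ + x • v), v⟫)) x :=
  ((hasDerivAt_logLik_line τ θ v x).const_mul κ).exp

/-- The second derivative of `exp (κ * logLik)` along a line. -/
theorem hasDerivAt_deriv_exp_logLik_line {H : ℕ} (κ : ℝ) (τ : Traj S A H) (θ v : Param S A)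
    (x : ℝ) :
    HasDerivAt (fun y : ℝ =>
        Real.exp (κ * logLik (θ + y • v) τ) * (κ * ⟪trajScore τ (θ + y • v), v⟫))
      (Real.exp (κ * logLik (θ + x • v) τ) * (κ ^ 2 * ⟪trajScore τ (θ + x • v), v⟫ ^ 2
        + κ * ⟪fderiv ℝ (trajScore τ) (θ + x • v) v, v⟫)) x := by
  refine ((hasDerivAt_exp_logLik_line κ τ θ v x).mul
    ((hasDerivAt_trajScore_line τ θ v x).const_mul κ)).congr_deriv ?_
  ring

/-- The quantity is the second derivative of `exp (κ * logLik)` along `v`, divided by the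
exponential itself. It is used with `κ = 1` for smoothness of the value and with `κ = 2` for the
second moment of the importance weights. -/
theorem ScoreBounds.abs_second_order_le {Mg Mh : ℝ} (hb : ScoreBounds S A Mg Mh) {H : ℕ}
    {κ : ℝ} (hκ : 0 ≤ κ) (τ : Traj S A H) (θ v : Param S A) :
    |κ ^ 2 * ⟪trajScore τ θ, v⟫ ^ 2 + κ * ⟪fderiv ℝ (trajScore τ) θ v, v⟫| ≤
      (κ ^ 2 * (H * Mg) ^ 2 + κ * (H * Mh)) * ‖v‖ ^ 2 := by
  have h1 : ⟪trajScore τ θ, v⟫ ^ 2 ≤ (H * Mg) ^ 2 * ‖v‖ ^ 2 := by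
    rw [← mul_pow]
    refine sq_le_sq' ?_ ?_
    · have := (abs_le.1 (abs_real_inner_le_norm (trajScore τ θ) v)).1
      have := mul_le_mul_of_nonneg_right (hb.norm_trajScore_le τ θ) (norm_nonneg v)
      linarith
    · have := (abs_le.1 (abs_real_inner_le_norm (trajScore τ θ) v)).2
      have := mul_le_mul_of_nonneg_right (hb.norm_trajScore_le τ θ) (norm_nonneg v)
      linarith
  have h2 : |⟪fderiv ℝ (trajScore τ) θ v, v⟫| ≤ (H * Mh) * ‖v‖ ^ 2 := by
    refine (abs_real_inner_le_norm _ _).trans ?_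
    rw [pow_two, ← mul_assoc]
    refine mul_le_mul_of_nonneg_right ?_ (norm_nonneg v)
    exact (ContinuousLinearMap.le_opNorm _ _).trans
      (mul_le_mul_of_nonneg_right (hb.norm_fderiv_trajScore_le τ θ) (norm_nonneg v))
  refine (abs_add_le _ _).trans ?_
  rw [abs_of_nonneg (by positivity), abs_mul, abs_of_nonneg hκ]
  nlinarith [mul_le_mul_of_nonneg_left h1 (sq_nonneg κ), mul_le_mul_of_nonneg_left h2 hκ]

end Trajectories

/-! ### Value, its gradient, smoothness, and bounds on the GPOMDP estimator. -/

section Value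

variable {S A : Type*} [Fintype S] [Fintype A]

theorem sum_Iic_eq_sum_castLE {E : Type*} [AddCommMonoid E] {H : ℕ} (h : Fin H) (F : Fin H → E) :
    ∑ j ∈ Finset.Iic h, F j = ∑ i : Fin (h + 1), F (Fin.castLE h.isLt i) := by
  symm
  refine Finset.sum_nbij (fun i : Fin (h + 1) => Fin.castLE h.isLt i) ?_ ?_ ?_ fun _ _ => rfl
  · intro i _
    rw [Finset.mem_Iic, Fin.le_def]
    exact Nat.le_of_lt_succ i.isLt
  · intro i _ j _ hij
    exact Fin.castLE_injective _ hij
  · intro j hj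
    rw [Finset.coe_Iic, Set.mem_Iic, Fin.le_def] at hj
    exact ⟨⟨j, Nat.lt_succ_of_le hj⟩, by simp, rfl⟩

/-- The reward at the last step of a nonempty trajectory. -/
def lastReward (M : FiniteMDP S A) {h : ℕ} (τ : Traj S A (h + 1)) : ℝ :=
  M.reward (τ.1 (Fin.last h).castSucc) (τ.2 (Fin.last h))

theorem lastReward_nonneg (M : FiniteMDP S A) {h : ℕ} (τ : Traj S A (h + 1)) :
    0 ≤ lastReward M τ := (M.reward_mem _ _).1

theorem lastReward_le_one (M : FiniteMDP S A) {h : ℕ} (τ : Traj S A (h + 1)) :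
    lastReward M τ ≤ 1 := (M.reward_mem _ _).2

theorem gpomdp_eq (M : FiniteMDP S A) (base : ℕ → ℝ) {H : ℕ} (θ : Param S A)
    (τ : Traj S A H) :
    gpomdp M base θ τ = ∑ h : Fin H,
      (M.disc ^ (h : ℕ) * lastReward M (τ.take h.isLt) - base h) •
        trajScore (τ.take h.isLt) θ := by
  refine Finset.sum_congr rfl fun h _ => ?_
  rw [← Finset.smul_sum, sum_Iic_eq_sum_castLE]
  rfl

theorem truncValue_eq [Nonempty A] (M : FiniteMDP S A) (μ : S → ℝ) (H : ℕ) (θ : Param S A) :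
    truncValue M μ H θ = ∑ h : Fin H, M.disc ^ (h : ℕ) *
      ∑ τ : Traj S A (h + 1), lastReward M τ * trajProb M μ θ τ := by
  unfold truncValue
  simp_rw [Finset.mul_sum]
  rw [Finset.sum_comm]
  refine Finset.sum_congr rfl fun h _ => ?_
  have := sum_trajProb_smul_take M μ θ h.isLt
    (fun τ : Traj S A (h + 1) => M.disc ^ (h : ℕ) * lastReward M τ)
  simp only [smul_eq_mul] at this
  refine Eq.trans ?_ (this.trans ?_)
  · rfl
  · exact Finset.sum_congr rfl fun _ _ => by ring

/-- The gradient of the truncated value function. -/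
noncomputable def truncGrad (M : FiniteMDP S A) (μ : S → ℝ) (H : ℕ) (θ : Param S A) : Param S A :=
  ∑ h : Fin H, M.disc ^ (h : ℕ) •
      ∑ τ : Traj S A (h + 1), lastReward M τ • trajProb M μ θ τ • trajScore τ θ

theorem hasGradientAt_truncValue [Nonempty A] (M : FiniteMDP S A) (μ : S → ℝ) (H : ℕ)
    (θ : Param S A) : HasGradientAt (truncValue M μ H) (truncGrad M μ H θ) θ := by
  rw [funext (truncValue_eq M μ H)]
  exact hasGradientAt_sum _ fun h _ => hasGradientAt_const_mul _ (hasGradientAt_sum_trajProb _ _ _ _)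

/-- The truncated GPOMDP estimator is unbiased. -/
theorem sum_trajProb_smul_gpomdp [Nonempty A] (M : FiniteMDP S A) {μ : S → ℝ}
    (hμ : μ ∈ stdSimplex ℝ S) (base : ℕ → ℝ) (H : ℕ) (θ : Param S A) :
    ∑ τ : Traj S A H, trajProb M μ θ τ • gpomdp M base θ τ = truncGrad M μ H θ := by
  simp_rw [gpomdp_eq, Finset.smul_sum]
  rw [Finset.sum_comm]
  refine Finset.sum_congr rfl fun h _ => ?_
  rw [sum_trajProb_smul_take M μ θ h.isLt (fun τ : Traj S A (h + 1) =>
    (M.disc ^ (h : ℕ) * lastReward M τ - base h) • trajScore τ θ), Finset.smul_sum]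
  -- The baseline multiplies a score of mean zero, so its contribution can be subtracted for free.
  have h0 := congrArg (fun x => base h • x) (sum_trajProb_smul_trajScore M hμ (H := h + 1) θ)
  simp only [Finset.smul_sum, smul_zero] at h0
  rw [← sub_zero (∑ τ : Traj S A (h + 1), _ • lastReward M τ • _), ← h0,
    ← Finset.sum_sub_distrib]
  refine Finset.sum_congr rfl fun τ _ => ?_
  simp only [smul_smul, ← sub_smul]
  congr 1
  ring

theorem sum_trajProb_smul_impWeight_gpomdp [Nonempty A] (M : FiniteMDP S A) {μ : S → ℝ}
    (hμ : μ ∈ stdSimplex ℝ S) (base : ℕ → ℝ) (H : ℕ) (θ' θ : Param S A) :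
    ∑ τ : Traj S A H, trajProb M μ θ τ • impWeight θ' θ τ • gpomdp M base θ' τ =
      truncGrad M μ H θ' := by
  simp_rw [smul_smul, trajProb_mul_impWeight]
  exact sum_trajProb_smul_gpomdp M hμ base H θ'

theorem sum_pow_mul_succ_le {γ : ℝ} (h0 : 0 ≤ γ) (h1 : γ < 1) (H : ℕ) :
    ∑ h : Fin H, γ ^ (h : ℕ) * ((h : ℕ) + 1 : ℝ) ≤ 1 / (1 - γ) ^ 2 := by
  have hn : ‖γ‖ < 1 := by rwa [Real.norm_of_nonneg h0]
  have h := hasSum_choose_mul_geometric_of_norm_lt_one 1 hn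
  rw [Fin.sum_univ_eq_sum_range (fun h => γ ^ h * ((h : ℕ) + 1 : ℝ))]
  refine le_trans (le_of_eq ?_) (sum_le_hasSum (Finset.range H) (fun i _ => by positivity) h)
  refine Finset.sum_congr rfl fun i _ => ?_
  simp [mul_comm]

/-- Compare `(h + 1) ^ 2` with `(h + 1) * (h + 2)`, which is twice a binomial coefficient with a
known generating series. -/
theorem sum_pow_mul_succ_sq_le {γ : ℝ} (h0 : 0 ≤ γ) (h1 : γ < 1) (H : ℕ) :
    ∑ h : Fin H, γ ^ (h : ℕ) * ((h : ℕ) + 1 : ℝ) ^ 2 ≤ 2 / (1 - γ) ^ 3 := by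
  have hn : ‖γ‖ < 1 := by rwa [Real.norm_of_nonneg h0]
  have h := (hasSum_choose_mul_geometric_of_norm_lt_one 2 hn).mul_left 2
  rw [Fin.sum_univ_eq_sum_range (fun h => γ ^ h * ((h : ℕ) + 1 : ℝ) ^ 2)]
  refine le_trans ?_ ((sum_le_hasSum (Finset.range H) (fun i _ => by positivity) h).trans_eq ?_)
  · refine Finset.sum_le_sum fun i _ => ?_
    have hc : (((i + 2).choose 2 : ℕ) : ℝ) = (i + 2) * (i + 1) / 2 := by
      rw [Nat.cast_choose_two]
      push_cast
      ring
    rw [hc]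
    have : 0 ≤ γ ^ i := pow_nonneg h0 i
    have hi : (0 : ℝ) ≤ i := Nat.cast_nonneg i
    nlinarith [mul_nonneg this (add_nonneg hi zero_le_one)]
  · rw [mul_one_div]

/-- Taylor's bound for the negated sum along the segment. Its second derivative is an average, under
the trajectory law at the current point, of terms of absolute value at most `K`; since that law has
mass one at every point, no factor for the number of trajectories appears. -/
theorem ScoreBounds.sum_trajProb_lower {Mg Mh : ℝ} [Nonempty A] (hb : ScoreBounds S A Mg Mh)
    (M : FiniteMDP S A) {μ : S → ℝ}
    (hμ : μ ∈ stdSimplex ℝ S) {H : ℕ} {f : Traj S A H → ℝ} (hf0 : ∀ τ, 0 ≤ f τ)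
    (hf1 : ∀ τ, f τ ≤ 1) (θ v : Param S A) :
    ∑ τ, f τ * trajProb M μ θ τ + ⟪∑ τ, f τ • trajProb M μ θ τ • trajScore τ θ, v⟫
      - ((H * Mg) ^ 2 + H * Mh) * ‖v‖ ^ 2 / 2 ≤ ∑ τ, f τ * trajProb M μ (θ + v) τ := by
  set K := ((H * Mg) ^ 2 + H * Mh) * ‖v‖ ^ 2 with hK
  have hd1 := fun x => HasDerivAt.fun_sum (u := Finset.univ) fun (τ : Traj S A H) _ =>
    (hasDerivAt_exp_logLik_line 1 τ θ v x).const_mul (-(f τ * trajBase M μ τ))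
  have hd2 := fun x => HasDerivAt.fun_sum (u := Finset.univ) fun (τ : Traj S A H) _ =>
    (hasDerivAt_deriv_exp_logLik_line 1 τ θ v x).const_mul (-(f τ * trajBase M μ τ))
  have h := le_quadratic_of_deriv_deriv_le (C := K) hd1 hd2 (fun x _ => by
    have e : K = ∑ τ : Traj S A H, trajProb M μ (θ + x • v) τ * K := by
      rw [← Finset.sum_mul, sum_trajProb M hμ, one_mul]
    rw [e]
    refine Finset.sum_le_sum fun τ _ => ?_
    have hb' := hb.abs_second_order_le zero_le_one τ (θ + x • v) v
    simp only [one_pow, one_mul, ← hK] at hb' ⊢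
    have hp := trajProb_nonneg M hμ (θ + x • v) τ
    set Q := ⟪trajScore τ (θ + x • v), v⟫ ^ 2 + ⟪fderiv ℝ (trajScore τ) (θ + x • v) v, v⟫
    have e2 : -(f τ * trajBase M μ τ) * (Real.exp (logLik (θ + x • v) τ) * Q) =
        trajProb M μ (θ + x • v) τ * (f τ * (-Q)) := by
      rw [trajProb_eq]; ring
    rw [e2]
    refine mul_le_mul_of_nonneg_left ?_ hp
    have := (abs_le.1 hb').1
    have hK0 : 0 ≤ K := (abs_nonneg _).trans hb'
    have := mul_le_mul_of_nonneg_left (show -Q ≤ K by linarith) (hf0 τ)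
    exact this.trans (mul_le_of_le_one_left hK0 (hf1 τ))) (Set.right_mem_Icc.2 zero_le_one)
  simp only [one_smul, zero_smul, add_zero, one_mul, mul_one, one_pow] at h
  have e1 : ∀ θ : Param S A, ∑ τ, -(f τ * trajBase M μ τ) * Real.exp (logLik θ τ) =
      -∑ τ, f τ * trajProb M μ θ τ := fun θ => by
    rw [← Finset.sum_neg_distrib]
    exact Finset.sum_congr rfl fun τ _ => by rw [trajProb_eq]; ring
  have e2 : ∑ τ, -(f τ * trajBase M μ τ) * (Real.exp (logLik θ τ) * ⟪trajScore τ θ, v⟫) =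
      -⟪∑ τ, f τ • trajProb M μ θ τ • trajScore τ θ, v⟫ := by
    rw [sum_inner, ← Finset.sum_neg_distrib]
    refine Finset.sum_congr rfl fun τ _ => ?_
    rw [inner_smul_left, inner_smul_left, trajProb_eq]
    simp
    ring
  rw [e1, e1, e2] at h
  linarith

/-- The reward at time `h` only involves `h + 1` actions, so its curvature is `(h + 1) ^ 2 * Mg ^ 2
+ (h + 1) * Mh`; the discounted sum of these is bounded uniformly in `H`. -/
theorem ScoreBounds.truncValue_lower {Mg Mh : ℝ} [Nonempty A] (hb : ScoreBounds S A Mg Mh)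
    (hMh : 0 ≤ Mh) (M : FiniteMDP S A) {μ : S → ℝ} (hμ : μ ∈ stdSimplex ℝ S) (H : ℕ)
    (θ v : Param S A) :
    truncValue M μ H θ + ⟪truncGrad M μ H θ, v⟫
      - (2 * Mg ^ 2 / (1 - M.disc) ^ 3 + Mh / (1 - M.disc) ^ 2) / 2 * ‖v‖ ^ 2
      ≤ truncValue M μ H (θ + v) := by
  have hγ0 := M.disc_mem.1.le
  have hγ1 := M.disc_mem.2
  have h1 : ∀ h : Fin H, M.disc ^ (h : ℕ) * (
      ∑ τ : Traj S A (h + 1), lastReward M τ * trajProb M μ θ τ +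
      ⟪∑ τ : Traj S A (h + 1), lastReward M τ • trajProb M μ θ τ • trajScore τ θ, v⟫
      - ((((h + 1 : ℕ) : ℝ) * Mg) ^ 2 + ((h + 1 : ℕ) : ℝ) * Mh) * ‖v‖ ^ 2 / 2) ≤
      M.disc ^ (h : ℕ) * ∑ τ : Traj S A (h + 1), lastReward M τ * trajProb M μ (θ + v) τ :=
    fun h => mul_le_mul_of_nonneg_left (hb.sum_trajProb_lower M hμ (lastReward_nonneg M)
      (lastReward_le_one M) θ v) (pow_nonneg hγ0 _)
  have h2 := Finset.sum_le_sum fun h (_ : h ∈ (Finset.univ : Finset (Fin H))) => h1 h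
  rw [truncValue_eq, truncValue_eq, truncGrad, sum_inner]
  refine le_trans ?_ h2
  simp_rw [mul_sub, mul_add, Finset.sum_sub_distrib, Finset.sum_add_distrib, real_inner_smul_left]
  refine sub_le_sub_left ?_ _
  have e : ∑ h : Fin H, M.disc ^ (h : ℕ) *
      (((((h + 1 : ℕ) : ℝ) * Mg) ^ 2 + ((h + 1 : ℕ) : ℝ) * Mh) * ‖v‖ ^ 2 / 2) =
      ((∑ h : Fin H, M.disc ^ (h : ℕ) * ((h : ℕ) + 1 : ℝ) ^ 2) * Mg ^ 2 +
        (∑ h : Fin H, M.disc ^ (h : ℕ) * ((h : ℕ) + 1 : ℝ)) * Mh) / 2 * ‖v‖ ^ 2 := by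
    simp_rw [Finset.sum_mul, ← Finset.sum_add_distrib, Finset.sum_div, Finset.sum_mul]
    refine Finset.sum_congr rfl fun h _ => ?_
    push_cast
    ring
  rw [e]
  have h3 := mul_le_mul_of_nonneg_right (sum_pow_mul_succ_sq_le hγ0 hγ1 H) (sq_nonneg Mg)
  have h4 := mul_le_mul_of_nonneg_right (sum_pow_mul_succ_le hγ0 hγ1 H) hMh
  refine mul_le_mul_of_nonneg_right ?_ (sq_nonneg _)
  have e3 : 2 / (1 - M.disc) ^ 3 * Mg ^ 2 = 2 * Mg ^ 2 / (1 - M.disc) ^ 3 := by ring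
  have e4 : 1 / (1 - M.disc) ^ 2 * Mh = Mh / (1 - M.disc) ^ 2 := by ring
  linarith

/-- The sharp Hessian bound `1` is used here rather than `Mh`; averaging over states and actions,
the barrier thus adds exactly `lam` to the smoothness constant. -/
theorem log_softmax_lower (θ v : Param S A) (s : S) (a : A) :
    Real.log (softmax θ s a) + ⟪score s a θ, v⟫ - ‖v‖ ^ 2 / 2 ≤
      Real.log (softmax (θ + v) s a) := by
  have h := le_quadratic_of_deriv_deriv_le (C := ‖v‖ ^ 2)
    (fun x => (HasGradientAt.hasDerivAt_line
      (hasGradientAt_log_softmax (θ + x • v) s a)).fun_neg)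
    (fun x => (HasFDerivAt.hasDerivAt_inner_line
      (differentiable_score s a (θ + x • v)).hasFDerivAt).fun_neg)
    (fun x _ => by
      refine (neg_le_abs _).trans ((abs_real_inner_le_norm _ _).trans ?_)
      rw [pow_two]
      refine mul_le_mul_of_nonneg_right ?_ (norm_nonneg v)
      refine (ContinuousLinearMap.le_opNorm _ _).trans ?_
      exact mul_le_of_le_one_left (norm_nonneg v) (norm_fderiv_score_le _ _ _))
    (Set.right_mem_Icc.2 zero_le_one)
  simp only [one_smul, zero_smul, add_zero, mul_one, one_pow] at h
  linarith

/-- The gradient of the regularized truncated value function. -/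
noncomputable def regGrad (M : FiniteMDP S A) (μ : S → ℝ) (H : ℕ) (lam : ℝ) (θ : Param S A) :
    Param S A :=
  truncGrad M μ H θ + barrierGrad lam θ

theorem hasGradientAt_regValue [Nonempty A] (M : FiniteMDP S A) (μ : S → ℝ) (H : ℕ) (lam : ℝ)
    (θ : Param S A) : HasGradientAt (regValue M μ H lam) (regGrad M μ H lam θ) θ := by
  have h : HasGradientAt (fun θ : Param S A => lam / ((Fintype.card A : ℝ) * Fintype.card S)
        * ∑ s : S, ∑ a : A, Real.log (softmax θ s a)) (barrierGrad lam θ) θ :=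
    hasGradientAt_const_mul _ (hasGradientAt_sum _ fun s _ => hasGradientAt_sum _ fun a _ =>
      hasGradientAt_log_softmax θ s a)
  rw [hasGradientAt_iff_hasFDerivAt, regGrad, map_add]
  exact ((hasGradientAt_truncValue M μ H θ).hasFDerivAt.add h.hasFDerivAt).add_const _

theorem gradient_regValue [Nonempty A] (M : FiniteMDP S A) (μ : S → ℝ) (H : ℕ) (lam : ℝ)
    (θ : Param S A) : gradient (regValue M μ H lam) θ = regGrad M μ H lam θ :=
  (hasGradientAt_regValue M μ H lam θ).gradient

theorem ScoreBounds.regValue_lower {Mg Mh : ℝ} [Nonempty A] [Nonempty S]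
    (hb : ScoreBounds S A Mg Mh)
    (hMh : 0 ≤ Mh) (M : FiniteMDP S A) {μ : S → ℝ} (hμ : μ ∈ stdSimplex ℝ S) (H : ℕ)
    {lam : ℝ} (hlam : 0 ≤ lam) (θ v : Param S A) :
    regValue M μ H lam θ + ⟪regGrad M μ H lam θ, v⟫
      - (2 * Mg ^ 2 / (1 - M.disc) ^ 3 + Mh / (1 - M.disc) ^ 2 + lam) / 2 * ‖v‖ ^ 2
      ≤ regValue M μ H lam (θ + v) := by
  have h1 := hb.truncValue_lower hMh M hμ H θ v
  have hA : (0 : ℝ) < Fintype.card A := by exact_mod_cast Fintype.card_pos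
  have hS : (0 : ℝ) < Fintype.card S := by exact_mod_cast Fintype.card_pos
  have h2 := Finset.sum_le_sum fun s (_ : s ∈ (Finset.univ : Finset S)) =>
    Finset.sum_le_sum fun a (_ : a ∈ (Finset.univ : Finset A)) => log_softmax_lower θ v s a
  have h3 := mul_le_mul_of_nonneg_left h2
    (show 0 ≤ lam / ((Fintype.card A : ℝ) * Fintype.card S) by positivity)
  simp_rw [Finset.sum_sub_distrib, Finset.sum_add_distrib, ← sum_inner] at h3
  rw [mul_sub, mul_add, ← real_inner_smul_left] at h3
  have h4 : lam / ((Fintype.card A : ℝ) * Fintype.card S) *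
      ∑ s : S, ∑ a : A, ‖v‖ ^ 2 / 2 = lam / 2 * ‖v‖ ^ 2 := by
    simp only [Finset.sum_const, Finset.card_univ, nsmul_eq_mul]
    field_simp
  rw [h4] at h3
  change _ + ⟪barrierGrad lam θ, v⟫ - _ ≤ _ at h3
  unfold regValue regGrad
  rw [inner_add_left]
  linarith

theorem ScoreBounds.norm_gpomdp_le {Mg Mh : ℝ} (hb : ScoreBounds S A Mg Mh) (hMg : 0 ≤ Mg)
    (M : FiniteMDP S A) {base : ℕ → ℝ} {H : ℕ}
    (hbase : ∀ h < H, ∀ s a, |M.disc ^ h * M.reward s a - base h| ≤ M.disc ^ h)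
    (θ : Param S A) (τ : Traj S A H) :
    ‖gpomdp M base θ τ‖ ≤ Mg / (1 - M.disc) ^ 2 := by
  rw [gpomdp_eq]
  have hγ0 := M.disc_mem.1.le
  have h : ∀ h : Fin H, ‖(M.disc ^ (h : ℕ) * lastReward M (τ.take h.isLt) - base h) •
      trajScore (τ.take h.isLt) θ‖ ≤ M.disc ^ (h : ℕ) * ((h : ℕ) + 1 : ℝ) * Mg := fun h => by
    rw [norm_smul, mul_assoc]
    refine mul_le_mul (hbase h h.isLt _ _) ?_ (norm_nonneg _) (pow_nonneg hγ0 _)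
    refine (hb.norm_trajScore_le _ _).trans_eq ?_
    push_cast
    rfl
  refine (norm_sum_le_of_le _ fun i _ => h i).trans ?_
  rw [← Finset.sum_mul]
  have := mul_le_mul_of_nonneg_right (sum_pow_mul_succ_le hγ0 M.disc_mem.2 H) hMg
  rwa [one_div_mul_eq_div] at this

theorem ScoreBounds.norm_gpomdp_sub_le {Mg Mh : ℝ} (hb : ScoreBounds S A Mg Mh) (hMh : 0 ≤ Mh)
    (M : FiniteMDP S A) {base : ℕ → ℝ} {H : ℕ}
    (hbase : ∀ h < H, ∀ s a, |M.disc ^ h * M.reward s a - base h| ≤ M.disc ^ h)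
    (θ θ' : Param S A) (τ : Traj S A H) :
    ‖gpomdp M base θ' τ - gpomdp M base θ τ‖ ≤ Mh / (1 - M.disc) ^ 2 * ‖θ' - θ‖ := by
  rw [gpomdp_eq, gpomdp_eq, ← Finset.sum_sub_distrib]
  have hγ0 := M.disc_mem.1.le
  have h : ∀ h : Fin H, ‖(M.disc ^ (h : ℕ) * lastReward M (τ.take h.isLt) - base h) •
      trajScore (τ.take h.isLt) θ' - (M.disc ^ (h : ℕ) * lastReward M (τ.take h.isLt) - base h) •
      trajScore (τ.take h.isLt) θ‖ ≤
      M.disc ^ (h : ℕ) * ((h : ℕ) + 1 : ℝ) * (Mh * ‖θ' - θ‖) := fun h => by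
    rw [← smul_sub, norm_smul, mul_assoc]
    refine mul_le_mul (hbase h h.isLt _ _) ?_ (norm_nonneg _) (pow_nonneg hγ0 _)
    rw [trajScore, trajScore, ← Finset.sum_sub_distrib]
    refine (norm_sum_le_of_le _ fun j _ => hb.norm_score_sub_le _ _ θ θ').trans_eq ?_
    simp
  refine (norm_sum_le_of_le _ fun i _ => h i).trans ?_
  rw [← Finset.sum_mul]
  have := mul_le_mul_of_nonneg_right (sum_pow_mul_succ_le hγ0 M.disc_mem.2 H)
    (mul_nonneg hMh (norm_nonneg (θ' - θ)))
  exact this.trans_eq (by ring)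

end Value

/-! ### Variance of the importance weights. -/

section ImportanceWeights

variable {S A : Type*} [Fintype S] [Fintype A]

theorem sum_trajProb_mul_impWeight [Nonempty A] (M : FiniteMDP S A) {μ : S → ℝ}
    (hμ : μ ∈ stdSimplex ℝ S) (H : ℕ) (θ' θ : Param S A) :
    ∑ τ : Traj S A H, trajProb M μ θ τ * impWeight θ' θ τ = 1 := by
  simp_rw [trajProb_mul_impWeight]
  exact sum_trajProb M hμ H θ'

theorem impWeightVar_eq [Nonempty A] (M : FiniteMDP S A) {μ : S → ℝ}
    (hμ : μ ∈ stdSimplex ℝ S) (H : ℕ) (θ' θ : Param S A) :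
    impWeightVar M μ H θ' θ =
      ∑ τ : Traj S A H, trajProb M μ θ τ * (impWeight θ' θ τ - 1) ^ 2 := by
  unfold impWeightVar
  rw [sum_trajProb_mul_impWeight M hμ]

theorem impWeightVar_eq_sub_one [Nonempty A] (M : FiniteMDP S A) {μ : S → ℝ}
    (hμ : μ ∈ stdSimplex ℝ S) (H : ℕ) (θ' θ : Param S A) :
    impWeightVar M μ H θ' θ =
      ∑ τ : Traj S A H, trajProb M μ θ τ * impWeight θ' θ τ ^ 2 - 1 := by
  rw [impWeightVar_eq M hμ]
  have : ∀ τ : Traj S A H, trajProb M μ θ τ * (impWeight θ' θ τ - 1) ^ 2 =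
      trajProb M μ θ τ * impWeight θ' θ τ ^ 2 - 2 * (trajProb M μ θ τ * impWeight θ' θ τ)
      + trajProb M μ θ τ := fun τ => by ring
  simp_rw [this]
  rw [Finset.sum_add_distrib, Finset.sum_sub_distrib, ← Finset.mul_sum, sum_trajProb M hμ,
    sum_trajProb_mul_impWeight M hμ]
  ring

/-- A function on `[0, 1]` that starts at `1` with slope `0` and satisfies `f'' ≤ 2 q f`
has `f 1 - 1 ≤ q f 1`. -/
theorem sub_one_le_of_deriv_deriv_le {f f' f'' : ℝ → ℝ} {q : ℝ} (hq : 0 ≤ q)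
    (hf : ∀ x, HasDerivAt f (f' x) x) (hf' : ∀ x, HasDerivAt f' (f'' x) x)
    (h0 : f 0 = 1) (h0' : f' 0 = 0) (hnn : 0 ≤ f 1)
    (hC : ∀ x ∈ Set.Icc (0 : ℝ) 1, f'' x ≤ 2 * q * f x) : f 1 - 1 ≤ q * f 1 := by
  -- Bounding `f''` by the maximum of `f` closes the estimate on itself, so nothing need be assumed
  -- about `f` at interior points.
  obtain ⟨x, hx, hmax⟩ := isCompact_Icc.exists_isMaxOn (Set.nonempty_Icc.2 (zero_le_one' ℝ))
    (fun y _ => (hf y).continuousAt.continuousWithinAt : ContinuousOn f (Set.Icc 0 1))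
  have hle : ∀ y ∈ Set.Icc (0 : ℝ) 1, f y ≤ f x := fun y hy => hmax hy
  have h1 := le_quadratic_of_deriv_deriv_le hf hf' (C := 2 * q * f x)
    (fun y hy => (hC y hy).trans (mul_le_mul_of_nonneg_left (hle y hy) (by positivity))) hx
  have hf1 := hle 1 (Set.right_mem_Icc.2 zero_le_one)
  have hfx : 0 ≤ q * f x := mul_nonneg hq (hnn.trans hf1)
  have hx2 : x ^ 2 ≤ 1 := pow_le_one₀ hx.1 hx.2
  rw [h0, h0'] at h1
  have h2 : f x - 1 ≤ q * f x := by nlinarith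
  -- For `q ≤ 1`, `(1 - q) * f 1 ≤ (1 - q) * f x ≤ 1`; for `q ≥ 1` the claim is trivial since `f 1 ≥
  -- 0`.
  rcases le_total q 1 with h | h <;> nlinarith

/-- The variance of the importance weights is at most quadratic in the parameter distance. -/
theorem ScoreBounds.impWeightVar_le {Mg Mh : ℝ} [Nonempty A] (hb : ScoreBounds S A Mg Mh)
    (hMh : 0 ≤ Mh) (M : FiniteMDP S A) {μ : S → ℝ} (hμ : μ ∈ stdSimplex ℝ S) (H : ℕ)
    {W : ℝ} (θ' θ : Param S A) (hW : impWeightVar M μ H θ' θ ≤ W) :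
    impWeightVar M μ H θ' θ ≤ H * (2 * H * Mg ^ 2 + Mh) * (W + 1) * ‖θ' - θ‖ ^ 2 := by
  set v := θ' - θ with hv
  set q := H * (2 * H * Mg ^ 2 + Mh) * ‖v‖ ^ 2 with hq
  have hq0 : 0 ≤ q := by positivity
  -- The weights `c τ` make the sum of `c τ * exp (2 * logLik (θ + x • v) τ)` the second moment of
  -- the importance weight of `θ + x • v` relative to `θ`. At `x = 1` it equals the variance plus
  -- one, hence is at most `W + 1`.
  set c : Traj S A H → ℝ := fun τ => trajBase M μ τ * Real.exp (- logLik θ τ) with hc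
  have hd1 := fun x => HasDerivAt.fun_sum (u := Finset.univ) fun (τ : Traj S A H) _ =>
    (hasDerivAt_exp_logLik_line 2 τ θ v x).const_mul (c τ)
  have hd2 := fun x => HasDerivAt.fun_sum (u := Finset.univ) fun (τ : Traj S A H) _ =>
    (hasDerivAt_deriv_exp_logLik_line 2 τ θ v x).const_mul (c τ)
  have hce : ∀ τ : Traj S A H, c τ * Real.exp (2 * logLik θ τ) = trajProb M μ θ τ := fun τ => by
    rw [hc, trajProb_eq]
    simp only [mul_assoc]
    rw [← Real.exp_add]
    congr 2
    ring
  have hc1 : ∑ τ : Traj S A H, c τ * Real.exp (2 * logLik θ' τ) =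
      ∑ τ : Traj S A H, trajProb M μ θ τ * impWeight θ' θ τ ^ 2 := by
    refine Finset.sum_congr rfl fun τ _ => ?_
    rw [hc, trajProb_eq, impWeight_eq, ← Real.exp_nat_mul]
    simp only [mul_assoc]
    rw [← Real.exp_add, ← Real.exp_add]
    congr 2
    push_cast
    ring
  have hcnn : ∀ τ, 0 ≤ c τ := fun τ =>
    nonneg_of_mul_nonneg_left ((hce τ).symm ▸ trajProb_nonneg M hμ θ τ) (Real.exp_pos _)
  have hv1 : θ + v = θ' := by rw [hv]; abel
  have h := sub_one_le_of_deriv_deriv_le hq0 hd1 hd2 ?_ ?_ ?_ ?_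
  · simp only [one_smul, hv1, hc1] at h
    have he := impWeightVar_eq_sub_one M hμ H θ' θ
    rw [← he] at h
    refine h.trans ?_
    have : ∑ τ : Traj S A H, trajProb M μ θ τ * impWeight θ' θ τ ^ 2 ≤ W + 1 := by linarith
    refine (mul_le_mul_of_nonneg_left this hq0).trans_eq ?_
    rw [hq]
    ring
  · simp only [zero_smul, add_zero, hce, sum_trajProb M hμ]
  · simp only [zero_smul, add_zero]
    have h0 := congrArg (fun x => 2 * ⟪x, v⟫) (sum_trajProb_smul_trajScore M hμ (H := H) θ)
    simp only [sum_inner, real_inner_smul_left, inner_zero_left, mul_zero, Finset.mul_sum] at h0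
    rw [← h0]
    refine Finset.sum_congr rfl fun τ _ => ?_
    rw [← mul_assoc, hce]
    ring
  · exact Finset.sum_nonneg fun τ _ => mul_nonneg (hcnn τ) (Real.exp_pos _).le
  · intro x _
    rw [Finset.mul_sum]
    refine Finset.sum_le_sum fun τ _ => ?_
    have h1 := (abs_le.1 (hb.abs_second_order_le zero_le_two τ (θ + x • v) v)).2
    have h2 : (2 ^ 2 * (H * Mg) ^ 2 + 2 * (H * Mh)) * ‖v‖ ^ 2 = 2 * q := by rw [hq]; ring
    rw [h2] at h1
    have := mul_le_mul_of_nonneg_left h1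
      (mul_nonneg (hcnn τ) (Real.exp_pos (2 * logLik (θ + x • v) τ)).le)
    linarith

end ImportanceWeights

/-! ### Existence of a maximizer. -/

section Maximizer

variable {S A : Type*} [Fintype S] [Fintype A]

theorem truncValue_le [Nonempty A] (M : FiniteMDP S A) {μ : S → ℝ} (hμ : μ ∈ stdSimplex ℝ S)
    (H : ℕ) (θ : Param S A) : truncValue M μ H θ ≤ H := by
  have h : ∀ τ : Traj S A H, ∑ h : Fin H, M.disc ^ (h : ℕ) *
      M.reward (τ.1 h.castSucc) (τ.2 h) ≤ H := fun τ => by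
    refine (Finset.sum_le_card_nsmul _ _ 1 fun h _ => ?_).trans_eq (by simp)
    exact mul_le_one₀ (pow_le_one₀ M.disc_mem.1.le M.disc_mem.2.le) (M.reward_mem _ _).1
      (M.reward_mem _ _).2
  refine (Finset.sum_le_sum fun τ _ =>
    mul_le_mul_of_nonneg_left (h τ) (trajProb_nonneg M hμ θ τ)).trans_eq ?_
  rw [← Finset.sum_mul, sum_trajProb M hμ, one_mul]

theorem regValue_congr (M : FiniteMDP S A) (μ : S → ℝ) (H : ℕ) (lam : ℝ) {θ θ' : Param S A}
    (h : ∀ s a, softmax θ s a = softmax θ' s a) :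
    regValue M μ H lam θ = regValue M μ H lam θ' := by
  unfold regValue truncValue trajProb
  simp only [h]

/-- The representative of `θ` whose entries are the log-probabilities of its policy. -/
noncomputable def logSoftmax (θ : Param S A) : Param S A :=
  WithLp.toLp 2 fun i => Real.log (softmax θ i.1 i.2)

theorem softmax_logSoftmax (θ : Param S A) (s : S) (a : A) :
    softmax (logSoftmax θ) s a = softmax θ s a := by
  have : Nonempty A := ⟨a⟩
  have h : ∀ a', Real.exp (logSoftmax θ (s, a')) = softmax θ s a' := fun a' =>
    Real.exp_log (softmax_pos θ s a')
  rw [softmax, h]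
  simp_rw [h]
  rw [sum_softmax, div_one]

/-- The objective depends on `θ` only through its policy, so `θ` may be replaced by its
log-probabilities. They are nonpositive, and where the objective is at least its value at `0`, the
barrier together with the bound `H` on the truncated value forces each of them above `-C`. A maximum
over the resulting compact box is therefore global. -/
theorem exists_forall_regValue_le [Nonempty S] [Nonempty A] (M : FiniteMDP S A) {μ : S → ℝ}
    (hμ : μ ∈ stdSimplex ℝ S) (H : ℕ) {lam : ℝ} (hlam : 0 < lam) :
    ∃ θs : Param S A, ∀ θ, regValue M μ H lam θ ≤ regValue M μ H lam θs := by
  have hA : (0 : ℝ) < Fintype.card A := by exact_mod_cast Fintype.card_pos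
  have hS : (0 : ℝ) < Fintype.card S := by exact_mod_cast Fintype.card_pos
  set κ := lam / ((Fintype.card A : ℝ) * Fintype.card S) with hκ
  have hκ0 : 0 < κ := by positivity
  set C := (H + lam * Real.log (Fintype.card A) - regValue M μ H lam (0 : Param S A)) / κ with hC
  set K : Set (Param S A) := WithLp.toLp 2 '' Set.Icc (fun _ => -C) (fun _ => 0) with hK
  have hKc : IsCompact K := isCompact_Icc.image (PiLp.continuous_toLp 2 _)
  have hmem : ∀ θ : Param S A, regValue M μ H lam 0 ≤ regValue M μ H lam θ →
      logSoftmax θ ∈ K := by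
    intro θ hθ
    have hnp : ∀ s a, Real.log (softmax θ s a) ≤ 0 := fun s a =>
      Real.log_nonpos (softmax_pos θ s a).le (softmax_le_one θ s a)
    refine ⟨fun i => Real.log (softmax θ i.1 i.2), ⟨fun i => ?_, fun i => hnp _ _⟩, rfl⟩
    have h1 : ∑ s : S, ∑ a : A, Real.log (softmax θ s a) ≤ Real.log (softmax θ i.1 i.2) := by
      have h2 := Finset.single_le_sum (f := fun j : S × A => -Real.log (softmax θ j.1 j.2))
        (fun j _ => neg_nonneg.2 (hnp _ _)) (Finset.mem_univ i)
      rw [Finset.sum_neg_distrib, Fintype.sum_prod_type] at h2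
      exact neg_le_neg_iff.1 h2
    have h3 := truncValue_le M hμ H θ
    have h4 : regValue M μ H lam θ = truncValue M μ H θ +
      κ * ∑ s : S, ∑ a : A, Real.log (softmax θ s a) + lam * Real.log (Fintype.card A) := rfl
    refine le_trans ?_ h1
    rw [hC, ← neg_div, div_le_iff₀ hκ0]
    linarith
  have hcont : ContinuousOn (regValue M μ H lam) K := fun θ _ =>
    (hasGradientAt_regValue M μ H lam θ).hasFDerivAt.continuousAt.continuousWithinAt
  obtain ⟨θs, _, hmax⟩ := hKc.exists_isMaxOn ⟨_, hmem 0 le_rfl⟩ hcont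
  have hle : ∀ θ, regValue M μ H lam 0 ≤ regValue M μ H lam θ →
      regValue M μ H lam θ ≤ regValue M μ H lam θs := fun θ hθ => by
    rw [← regValue_congr M μ H lam (softmax_logSoftmax θ)]
    exact hmax (hmem θ hθ)
  refine ⟨θs, fun θ => ?_⟩
  rcases le_total (regValue M μ H lam 0) (regValue M μ H lam θ) with h | h
  · exact hle θ h
  · exact h.trans (hle 0 le_rfl)

end Maximizer

/-! ### Second moments of sums of independent centred vectors. -/

section Batches

variable {E : Type*} [NormedAddCommGroup E] [InnerProductSpace ℝ E]

theorem norm_add_sq_le_two_mul (x y : E) : ‖x + y‖ ^ 2 ≤ 2 * ‖x‖ ^ 2 + 2 * ‖y‖ ^ 2 := by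
  nlinarith [norm_add_le x y, norm_nonneg (x + y), sq_nonneg (‖x‖ - ‖y‖), norm_nonneg x,
    norm_nonneg y]

theorem sum_mul_norm_add_sq {α : Type*} [Fintype α] {p : α → ℝ} (hp : ∑ a, p a = 1) {Z : α → E}
    (hZ : ∑ a, p a • Z a = 0) (v : E) :
    ∑ a, p a * ‖v + Z a‖ ^ 2 = ‖v‖ ^ 2 + ∑ a, p a * ‖Z a‖ ^ 2 := by
  have h : ∑ a, p a * ⟪v, Z a⟫ = 0 := by
    have := congrArg (fun x => ⟪v, x⟫) hZ
    simpa [inner_sum, real_inner_smul_right] using this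
  have h' : ∀ a, p a * ‖v + Z a‖ ^ 2 =
      p a * ‖v‖ ^ 2 + 2 * (p a * ⟪v, Z a⟫) + p a * ‖Z a‖ ^ 2 := fun a => by
    rw [norm_add_sq_real]; ring
  simp_rw [h']
  rw [Finset.sum_add_distrib, Finset.sum_add_distrib, ← Finset.mul_sum, h, ← Finset.sum_mul, hp]
  ring

/-- The second moment of a centred random vector is at most the raw second moment. -/
theorem sum_mul_norm_sub_sq_le {α : Type*} [Fintype α] {p : α → ℝ} (hp : ∑ a, p a = 1)
    {X : α → E} {m : E} (hm : ∑ a, p a • X a = m) :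
    ∑ a, p a * ‖X a - m‖ ^ 2 ≤ ∑ a, p a * ‖X a‖ ^ 2 := by
  have h0 : ∑ a, p a • (X a - m) = 0 := by
    simp_rw [smul_sub, Finset.sum_sub_distrib, ← Finset.sum_smul, hp, hm, one_smul, sub_self]
  have h := sum_mul_norm_add_sq hp h0 m
  simp only [add_sub_cancel] at h
  rw [h]
  linarith [sq_nonneg ‖m‖]

/-- The second moment of a sum of independent centred random vectors with a common law. -/
theorem sum_prod_mul_norm_add_sum_sq {α : Type*} [Fintype α] {p : α → ℝ} (hp : ∑ a, p a = 1)
    {Z : α → E} (hZ : ∑ a, p a • Z a = 0) (B : ℕ) (v : E) :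
    ∑ y : Fin B → α, (∏ i, p (y i)) * ‖v + ∑ i, Z (y i)‖ ^ 2 =
      ‖v‖ ^ 2 + B * ∑ a, p a * ‖Z a‖ ^ 2 := by
  induction B generalizing v with
  | zero => simp
  | succ B ih =>
    rw [← (Fin.consEquiv fun _ : Fin (B + 1) => α).sum_comp, Fintype.sum_prod_type]
    have h : ∀ a, ∑ y : Fin B → α,
        (∏ i, p ((Fin.consEquiv fun _ : Fin (B + 1) => α) (a, y) i)) *
          ‖v + ∑ i, Z ((Fin.consEquiv fun _ : Fin (B + 1) => α) (a, y) i)‖ ^ 2 =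
        p a * ‖v + Z a‖ ^ 2 + p a * (B * ∑ a, p a * ‖Z a‖ ^ 2) := fun a => by
      rw [← mul_add, ← ih, Finset.mul_sum]
      refine Finset.sum_congr rfl fun y _ => ?_
      simp only [Fin.consEquiv_apply, Fin.prod_univ_succ, Fin.sum_univ_succ, Fin.cons_zero,
        Fin.cons_succ]
      rw [add_assoc, mul_assoc]
    rw [Finset.sum_congr rfl fun a _ => h a, Finset.sum_add_distrib, sum_mul_norm_add_sq hp hZ,
      ← Finset.sum_mul, hp]
    push_cast
    ring

end Batches

/-! ### One-step conditional error bounds for the estimator. -/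

section MomentBounds

variable {S A : Type*} [Fintype S] [Fintype A]

theorem ScoreBounds.sum_trajProb_mul_norm_gpomdp_sub_sq_le {Mg Mh : ℝ} [Nonempty A]
    (hb : ScoreBounds S A Mg Mh) (hMg : 0 ≤ Mg)
    (M : FiniteMDP S A) {μ : S → ℝ} (hμ : μ ∈ stdSimplex ℝ S) {base : ℕ → ℝ} {H : ℕ}
    (hbase : ∀ h < H, ∀ s a, |M.disc ^ h * M.reward s a - base h| ≤ M.disc ^ h)
    (θ : Param S A) :
    ∑ τ : Traj S A H, trajProb M μ θ τ * ‖gpomdp M base θ τ - truncGrad M μ H θ‖ ^ 2 ≤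
      (Mg / (1 - M.disc) ^ 2) ^ 2 := by
  refine (sum_mul_norm_sub_sq_le (sum_trajProb M hμ H θ)
    (sum_trajProb_smul_gpomdp M hμ base H θ)).trans ?_
  refine (Finset.sum_le_sum fun τ _ => mul_le_mul_of_nonneg_left (pow_le_pow_left₀ (norm_nonneg _)
    (hb.norm_gpomdp_le hMg M hbase θ τ) 2) (trajProb_nonneg M hμ θ τ)).trans_eq ?_
  rw [← Finset.sum_mul, sum_trajProb M hμ, one_mul]

theorem ScoreBounds.sum_trajProb_mul_norm_correction_sq_le {Mg Mh : ℝ} [Nonempty A]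
    (hb : ScoreBounds S A Mg Mh) (hMg : 0 ≤ Mg) (hMh : 0 ≤ Mh)
    (M : FiniteMDP S A) {μ : S → ℝ} (hμ : μ ∈ stdSimplex ℝ S) {base : ℕ → ℝ} {H : ℕ}
    (hbase : ∀ h < H, ∀ s a, |M.disc ^ h * M.reward s a - base h| ≤ M.disc ^ h)
    (θ' θ : Param S A) :
    ∑ τ : Traj S A H, trajProb M μ θ τ *
      ‖gpomdp M base θ τ - impWeight θ' θ τ • gpomdp M base θ' τ
        - (truncGrad M μ H θ - truncGrad M μ H θ')‖ ^ 2 ≤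
      2 * (Mh / (1 - M.disc) ^ 2) ^ 2 * ‖θ - θ'‖ ^ 2
        + 2 * (Mg / (1 - M.disc) ^ 2) ^ 2 * impWeightVar M μ H θ' θ := by
  have hm : ∑ τ : Traj S A H, trajProb M μ θ τ •
      (gpomdp M base θ τ - impWeight θ' θ τ • gpomdp M base θ' τ) =
      truncGrad M μ H θ - truncGrad M μ H θ' := by
    simp_rw [smul_sub, Finset.sum_sub_distrib]
    rw [sum_trajProb_smul_gpomdp M hμ, sum_trajProb_smul_impWeight_gpomdp M hμ]
  refine (sum_mul_norm_sub_sq_le (sum_trajProb M hμ H θ) hm).trans ?_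
  set Lg := Mh / (1 - M.disc) ^ 2
  set G := Mg / (1 - M.disc) ^ 2
  have h : ∀ τ : Traj S A H, trajProb M μ θ τ *
      ‖gpomdp M base θ τ - impWeight θ' θ τ • gpomdp M base θ' τ‖ ^ 2 ≤
      trajProb M μ θ τ * (2 * Lg ^ 2 * ‖θ - θ'‖ ^ 2) +
        2 * G ^ 2 * (trajProb M μ θ τ * (impWeight θ' θ τ - 1) ^ 2) := fun τ => by
    -- The first part is controlled by the Lipschitz bound on the estimator, the second by the
    -- deviation of the weight from its mean `1`.
    have e : gpomdp M base θ τ - impWeight θ' θ τ • gpomdp M base θ' τ =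
        (gpomdp M base θ τ - gpomdp M base θ' τ) +
          (1 - impWeight θ' θ τ) • gpomdp M base θ' τ := by
      rw [sub_smul, one_smul]; abel
    have h1 := pow_le_pow_left₀ (norm_nonneg _) (hb.norm_gpomdp_sub_le hMh M hbase θ' θ τ) 2
    have h2 := pow_le_pow_left₀ (norm_nonneg _) (hb.norm_gpomdp_le hMg M hbase θ' τ) 2
    have h3 : ‖(1 - impWeight θ' θ τ) • gpomdp M base θ' τ‖ ^ 2 ≤
        (impWeight θ' θ τ - 1) ^ 2 * G ^ 2 := by
      rw [norm_smul, mul_pow, Real.norm_eq_abs, sq_abs, ← neg_sq (1 - _), neg_sub]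
      exact mul_le_mul_of_nonneg_left h2 (sq_nonneg _)
    have h4 := norm_add_sq_le_two_mul (gpomdp M base θ τ - gpomdp M base θ' τ)
      ((1 - impWeight θ' θ τ) • gpomdp M base θ' τ)
    rw [← e] at h4
    rw [mul_pow] at h1
    refine (mul_le_mul_of_nonneg_left (h4.trans (add_le_add
      (mul_le_mul_of_nonneg_left h1 zero_le_two) (mul_le_mul_of_nonneg_left h3 zero_le_two)))
      (trajProb_nonneg M hμ θ τ)).trans_eq ?_
    ring
  refine (Finset.sum_le_sum fun τ _ => h τ).trans_eq ?_
  rw [Finset.sum_add_distrib, ← Finset.sum_mul, sum_trajProb M hμ, one_mul, ← Finset.mul_sum,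
    impWeightVar_eq M hμ]

theorem ScoreBounds.batch_error_init_le {Mg Mh : ℝ} [Nonempty A]
    (hb : ScoreBounds S A Mg Mh) (hMg : 0 ≤ Mg)
    (M : FiniteMDP S A) {μ : S → ℝ} (hμ : μ ∈ stdSimplex ℝ S) {base : ℕ → ℝ} {H : ℕ}
    (hbase : ∀ h < H, ∀ s a, |M.disc ^ h * M.reward s a - base h| ≤ M.disc ^ h)
    {B : ℕ} (hB : 1 ≤ B) (θ : Param S A) :
    ∑ y : Fin B → Traj S A H, (∏ i, trajProb M μ θ (y i)) *
      ‖(1 / (B : ℝ)) • ∑ i, gpomdp M base θ (y i) - truncGrad M μ H θ‖ ^ 2 ≤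
      (Mg / (1 - M.disc) ^ 2) ^ 2 / B := by
  have hB0 : (0 : ℝ) < B := by exact_mod_cast hB
  set Z : Traj S A H → Param S A := fun τ =>
    (1 / (B : ℝ)) • (gpomdp M base θ τ - truncGrad M μ H θ) with hZ
  have hZ0 : ∑ τ, trajProb M μ θ τ • Z τ = 0 := by
    simp_rw [hZ, smul_comm _ (1 / (B : ℝ)), ← Finset.smul_sum, smul_sub, Finset.sum_sub_distrib,
      ← Finset.sum_smul, sum_trajProb M hμ, sum_trajProb_smul_gpomdp M hμ, one_smul, sub_self,
      smul_zero]
  have h := sum_prod_mul_norm_add_sum_sq (sum_trajProb M hμ H θ) hZ0 B 0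
  have e : ∀ y : Fin B → Traj S A H, 0 + ∑ i, Z (y i) =
      (1 / (B : ℝ)) • ∑ i, gpomdp M base θ (y i) - truncGrad M μ H θ := fun y => by
    simp_rw [hZ, ← Finset.smul_sum, Finset.sum_sub_distrib, smul_sub, zero_add]
    simp [← Nat.cast_smul_eq_nsmul ℝ, smul_smul, hB0.ne']
  simp_rw [e] at h
  rw [h, norm_zero]
  have e2 : ∑ τ, trajProb M μ θ τ * ‖Z τ‖ ^ 2 = (1 / (B : ℝ)) ^ 2 *
      ∑ τ : Traj S A H, trajProb M μ θ τ * ‖gpomdp M base θ τ - truncGrad M μ H θ‖ ^ 2 := by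
    rw [Finset.mul_sum]
    refine Finset.sum_congr rfl fun τ _ => ?_
    rw [hZ, norm_smul, mul_pow, Real.norm_eq_abs, sq_abs]
    ring
  rw [e2]
  have h2 := hb.sum_trajProb_mul_norm_gpomdp_sub_sq_le hMg M hμ hbase θ
  have h3 := mul_le_mul_of_nonneg_left h2 (show (0 : ℝ) ≤ 1 / B by positivity)
  refine le_trans (le_of_eq ?_) (h3.trans_eq ?_)
  · field_simp
    ring
  · ring

/-- The error splits into the frozen vector `(1 - β) • (u - truncGrad M μ H θ')` and a sum over the
batch of independent centred `Z`. Orthogonality keeps the factor `(1 - β) ^ 2` on the old error and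
gives the noise a factor `1 / B`. -/
theorem ScoreBounds.batch_error_succ_le {Mg Mh : ℝ} [Nonempty A]
    (hb : ScoreBounds S A Mg Mh) (hMg : 0 ≤ Mg) (hMh : 0 ≤ Mh)
    (M : FiniteMDP S A) {μ : S → ℝ} (hμ : μ ∈ stdSimplex ℝ S) {base : ℕ → ℝ} {H : ℕ}
    (hbase : ∀ h < H, ∀ s a, |M.disc ^ h * M.reward s a - base h| ≤ M.disc ^ h)
    {B : ℕ} (hB : 1 ≤ B) (β : ℝ) (θ' θ u : Param S A) :
    ∑ y : Fin B → Traj S A H, (∏ i, trajProb M μ θ (y i)) *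
      ‖(β / (B : ℝ)) • ∑ i, gpomdp M base θ (y i)
        + (1 - β) • (u + (1 / (B : ℝ)) • ∑ i, (gpomdp M base θ (y i)
          - impWeight θ' θ (y i) • gpomdp M base θ' (y i))) - truncGrad M μ H θ‖ ^ 2 ≤
      (1 - β) ^ 2 * ‖u - truncGrad M μ H θ'‖ ^ 2
        + 2 * β ^ 2 * (Mg / (1 - M.disc) ^ 2) ^ 2 / B
        + 4 * (1 - β) ^ 2 * ((Mh / (1 - M.disc) ^ 2) ^ 2 * ‖θ - θ'‖ ^ 2
          + (Mg / (1 - M.disc) ^ 2) ^ 2 * impWeightVar M μ H θ' θ) / B := by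
  have hB0 : (0 : ℝ) < B := by exact_mod_cast hB
  set X : Traj S A H → Param S A := fun τ => gpomdp M base θ τ - truncGrad M μ H θ with hX
  set Y : Traj S A H → Param S A := fun τ =>
    gpomdp M base θ τ - impWeight θ' θ τ • gpomdp M base θ' τ
        - (truncGrad M μ H θ - truncGrad M μ H θ') with hY
  set Z : Traj S A H → Param S A := fun τ =>
    (β / (B : ℝ)) • X τ + ((1 - β) / (B : ℝ)) • Y τ with hZ
  have hX0 : ∑ τ, trajProb M μ θ τ • X τ = 0 := by
    simp_rw [hX, smul_sub, Finset.sum_sub_distrib,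
      ← Finset.sum_smul, sum_trajProb M hμ, sum_trajProb_smul_gpomdp M hμ, one_smul, sub_self]
  have hY0 : ∑ τ, trajProb M μ θ τ • Y τ = 0 := by
    simp_rw [hY, smul_sub, Finset.sum_sub_distrib,
      ← Finset.sum_smul, sum_trajProb M hμ, sum_trajProb_smul_gpomdp M hμ,
      sum_trajProb_smul_impWeight_gpomdp M hμ, one_smul, sub_self]
  have hZ0 : ∑ τ, trajProb M μ θ τ • Z τ = 0 := by
    simp_rw [hZ, smul_add, Finset.sum_add_distrib, smul_comm _ (β / (B : ℝ)),
      smul_comm _ ((1 - β) / (B : ℝ)), ← Finset.smul_sum, hX0, hY0, smul_zero, add_zero]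
  have h := sum_prod_mul_norm_add_sum_sq (sum_trajProb M hμ H θ) hZ0 B
    ((1 - β) • (u - truncGrad M μ H θ'))
  have e : ∀ y : Fin B → Traj S A H, (1 - β) • (u - truncGrad M μ H θ') + ∑ i, Z (y i) =
      (β / (B : ℝ)) • ∑ i, gpomdp M base θ (y i)
        + (1 - β) • (u + (1 / (B : ℝ)) • ∑ i, (gpomdp M base θ (y i)
          - impWeight θ' θ (y i) • gpomdp M base θ' (y i))) - truncGrad M μ H θ := fun y => by
    have hc : ∀ g : Param S A, ∑ _i : Fin B, g = (B : ℝ) • g := fun g => by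
      simp [← Nat.cast_smul_eq_nsmul ℝ]
    have h1 : ∑ i, Z (y i) = (β / (B : ℝ)) • (∑ i, gpomdp M base θ (y i)
        - (B : ℝ) • truncGrad M μ H θ)
        + ((1 - β) / (B : ℝ)) • (∑ i, (gpomdp M base θ (y i)
          - impWeight θ' θ (y i) • gpomdp M base θ' (y i))
          - (B : ℝ) • (truncGrad M μ H θ - truncGrad M μ H θ')) := by
      rw [← hc, ← hc, ← Finset.sum_sub_distrib, ← Finset.sum_sub_distrib, Finset.smul_sum,
        Finset.smul_sum, ← Finset.sum_add_distrib]
    rw [h1]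
    generalize ∑ i, (gpomdp M base θ (y i)
          - impWeight θ' θ (y i) • gpomdp M base θ' (y i)) = D
    match_scalars <;> field_simp <;> ring
  simp_rw [e] at h
  rw [h, norm_smul, mul_pow, Real.norm_eq_abs, sq_abs]
  have h1 := hb.sum_trajProb_mul_norm_gpomdp_sub_sq_le hMg M hμ hbase θ
  have h2 := hb.sum_trajProb_mul_norm_correction_sq_le hMg hMh M hμ hbase θ' θ
  set V := impWeightVar M μ H θ' θ
  set Lg := Mh / (1 - M.disc) ^ 2
  set G := Mg / (1 - M.disc) ^ 2
  have h3 : ∑ τ, trajProb M μ θ τ * ‖Z τ‖ ^ 2 ≤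
      2 * (β / B) ^ 2 * G ^ 2 +
      2 * ((1 - β) / B) ^ 2 * (2 * Lg ^ 2 * ‖θ - θ'‖ ^ 2 + 2 * G ^ 2 * V) := by
    have h4 : ∀ τ, trajProb M μ θ τ * ‖Z τ‖ ^ 2 ≤
        2 * (β / B) ^ 2 * (trajProb M μ θ τ * ‖X τ‖ ^ 2) +
        2 * ((1 - β) / B) ^ 2 * (trajProb M μ θ τ * ‖Y τ‖ ^ 2) := fun τ => by
      refine (mul_le_mul_of_nonneg_left (norm_add_sq_le_two_mul _ _)
        (trajProb_nonneg M hμ θ τ)).trans_eq ?_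
      rw [norm_smul, norm_smul, mul_pow, mul_pow, Real.norm_eq_abs, Real.norm_eq_abs, sq_abs,
        sq_abs]
      ring
    refine (Finset.sum_le_sum fun τ _ => h4 τ).trans ?_
    rw [Finset.sum_add_distrib, ← Finset.mul_sum, ← Finset.mul_sum]
    exact add_le_add (mul_le_mul_of_nonneg_left h1 (by positivity))
      (mul_le_mul_of_nonneg_left h2 (by positivity))
  have h5 := mul_le_mul_of_nonneg_left h3 hB0.le
  rw [add_assoc]
  refine add_le_add le_rfl (h5.trans_eq ?_)
  field_simp
  ring

end MomentBounds

/-! ### Integrals of functions of a finite-valued map. -/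

section FiniteValued

variable {Ω ι : Type*} [MeasurableSpace Ω] [Fintype ι]

theorem comp_eq_sum_indicator (X : Ω → ι) (g : ι → ℝ) :
    (fun ω => g (X ω)) = fun ω => ∑ x, (X ⁻¹' {x}).indicator (fun _ => g x) ω := by
  classical
  funext ω
  rw [Finset.sum_eq_single (X ω)]
  · simp
  · intro x _ hx
    exact Set.indicator_of_notMem (fun h => hx h.symm) _
  · simp

theorem integrable_comp_of_fintype (P : Measure Ω) [IsFiniteMeasure P] {X : Ω → ι}
    (hX : ∀ x, MeasurableSet (X ⁻¹' {x})) (g : ι → ℝ) : Integrable (fun ω => g (X ω)) P := by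
  rw [comp_eq_sum_indicator]
  exact integrable_finsetSum _ fun x _ => (integrable_const (g x)).indicator (hX x)

theorem integral_comp_of_fintype (P : Measure Ω) [IsFiniteMeasure P] {X : Ω → ι}
    (hX : ∀ x, MeasurableSet (X ⁻¹' {x})) (g : ι → ℝ) :
    ∫ ω, g (X ω) ∂P = ∑ x, P.real (X ⁻¹' {x}) * g x := by
  rw [comp_eq_sum_indicator,
    integral_finsetSum _ fun x _ => (integrable_const (g x)).indicator (hX x)]
  refine Finset.sum_congr rfl fun x _ => ?_
  rw [integral_indicator_const _ (hX x), smul_eq_mul]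

end FiniteValued

/-! ### Conditioning on the batches drawn so far. -/

section Histories

variable {Ω Y : Type*}

/-- Two outcomes with the same batches before time `t`. -/
def SameHistory (τ : ℕ → Ω → Y) (t : ℕ) (ω ω' : Ω) : Prop :=
  ∀ t', 1 ≤ t' → t' < t → τ t' ω = τ t' ω'

theorem SameHistory.symm {τ : ℕ → Ω → Y} {t : ℕ} {ω ω' : Ω} (h : SameHistory τ t ω ω') :
    SameHistory τ t ω' ω := fun t' h1 h2 => (h t' h1 h2).symm

theorem SameHistory.mono {τ : ℕ → Ω → Y} {s t : ℕ} (hst : s ≤ t) {ω ω' : Ω}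
    (h : SameHistory τ t ω ω') : SameHistory τ s ω ω' :=
  fun t' h1 h2 => h t' h1 (h2.trans_le hst)

/-- The batches before time `t`. -/
def history (τ : ℕ → Ω → Y) (t : ℕ) (ω : Ω) : Finset.Ico 1 t → Y := fun i => τ i ω

theorem history_eq_iff {τ : ℕ → Ω → Y} {t : ℕ} {ω ω' : Ω} :
    history τ t ω = history τ t ω' ↔ SameHistory τ t ω ω' := by
  constructor
  · intro h t' h1 h2
    exact congrFun h ⟨t', Finset.mem_Ico.2 ⟨h1, h2⟩⟩
  · intro h
    funext i
    exact h i (Finset.mem_Ico.1 i.2).1 (Finset.mem_Ico.1 i.2).2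

variable [MeasurableSpace Ω] [Fintype Y]

theorem measurableSet_history {τ : ℕ → Ω → Y} {T t : ℕ} (htT : t ≤ T)
    (hτ : ∀ t, 1 ≤ t → t < T → ∀ y, MeasurableSet {ω | τ t ω = y}) (x : Finset.Ico 1 t → Y) :
    MeasurableSet (history τ t ⁻¹' {x}) := by
  have : history τ t ⁻¹' {x} = ⋂ i : Finset.Ico 1 t, {ω | τ i ω = x i} := by
    ext ω
    simp only [Set.mem_preimage, Set.mem_singleton_iff, Set.mem_iInter, Set.mem_ofPred_eq]
    exact funext_iff
  rw [this]
  exact MeasurableSet.iInter fun i => hτ i (Finset.mem_Ico.1 i.2).1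
    ((Finset.mem_Ico.1 i.2).2.trans_le htT) _

/-- Such an `f` factors through the history, which takes finitely many values with measurable
fibres. No measurability of the iterates has to be assumed. -/
theorem integrable_of_sameHistory (P : Measure Ω) [IsProbabilityMeasure P] {τ : ℕ → Ω → Y}
    {T t : ℕ} (htT : t ≤ T)
    (hτ : ∀ t, 1 ≤ t → t < T → ∀ y, MeasurableSet {ω | τ t ω = y}) {f : Ω → ℝ}
    (hf : ∀ ω ω', SameHistory τ t ω ω' → f ω = f ω') : Integrable f P := by
  classical
  have : Nonempty Ω := nonempty_of_isProbabilityMeasure P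
  have h := integrable_comp_of_fintype P (measurableSet_history htT hτ)
    (fun x => f (Function.invFun (history τ t) x))
  refine h.congr (Filter.Eventually.of_forall fun ω => ?_)
  exact hf _ _ (history_eq_iff.1 (Function.invFun_eq ⟨ω, rfl⟩))

/-- Integrating out the batch of time `t` given the earlier ones. -/
theorem integral_batch_eq (P : Measure Ω) [IsProbabilityMeasure P] {τ : ℕ → Ω → Y}
    {T t : ℕ} (ht : 1 ≤ t) (htT : t < T)
    (hτ : ∀ t, 1 ≤ t → t < T → ∀ y, MeasurableSet {ω | τ t ω = y}) {q F : Ω → Y → ℝ}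
    (hq : ∀ ω ω', SameHistory τ t ω ω' → q ω = q ω') (hq0 : ∀ ω y, 0 ≤ q ω y)
    (hlaw : ∀ ω₀ y, P {ω | SameHistory τ t ω ω₀ ∧ τ t ω = y} =
      P {ω | SameHistory τ t ω ω₀} * ENNReal.ofReal (q ω₀ y))
    (hF : ∀ ω ω', SameHistory τ t ω ω' → F ω = F ω') :
    ∫ ω, F ω (τ t ω) ∂P = ∫ ω, ∑ y, q ω y * F ω y ∂P := by
  classical
  have : Nonempty Ω := nonempty_of_isProbabilityMeasure P
  -- A representative outcome for each history turns `q` and `F` into functions on a finite set.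
  set r := Function.invFun (history τ t) with hr
  have hrs : ∀ ω, SameHistory τ t ω (r (history τ t ω)) := fun ω =>
    (history_eq_iff.1 (Function.invFun_eq ⟨ω, rfl⟩)).symm
  have hmh := measurableSet_history htT.le hτ
  have hm : ∀ x : (Finset.Ico 1 t → Y) × Y,
      MeasurableSet ((fun ω => (history τ t ω, τ t ω)) ⁻¹' {x}) := fun x => by
    have : (fun ω => (history τ t ω, τ t ω)) ⁻¹' {x} =
        history τ t ⁻¹' {x.1} ∩ {ω | τ t ω = x.2} := by
      ext ω
      simp [Prod.ext_iff]
    rw [this]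
    exact (hmh _).inter (hτ t ht htT _)
  have h1 : ∫ ω, F ω (τ t ω) ∂P = ∫ ω, (fun x : (Finset.Ico 1 t → Y) × Y => F (r x.1) x.2)
      (history τ t ω, τ t ω) ∂P :=
    integral_congr_ae (Filter.Eventually.of_forall fun ω => congrFun (hF _ _ (hrs ω)) _)
  have h2 : ∫ ω, ∑ y, q ω y * F ω y ∂P =
      ∫ ω, (fun x => ∑ y, q (r x) y * F (r x) y) (history τ t ω) ∂P :=
    integral_congr_ae (Filter.Eventually.of_forall fun ω =>
      Finset.sum_congr rfl fun y _ => by rw [hq _ _ (hrs ω), hF _ _ (hrs ω)])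
  refine (h1.trans (integral_comp_of_fintype P hm fun x => F (r x.1) x.2)).trans
    (Eq.trans ?_ (h2.trans
      (integral_comp_of_fintype P hmh fun x => ∑ y, q (r x) y * F (r x) y)).symm)
  rw [Fintype.sum_prod_type]
  refine Finset.sum_congr rfl fun x _ => ?_
  rw [Finset.mul_sum]
  refine Finset.sum_congr rfl fun y _ => ?_
  rw [← mul_assoc]
  congr 1
  by_cases hx : ∃ ω, history τ t ω = x
  · have hrx : history τ t (r x) = x := Function.invFun_eq hx
    have e1 : (fun ω => (history τ t ω, τ t ω)) ⁻¹' {(x, y)} =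
        {ω | SameHistory τ t ω (r x) ∧ τ t ω = y} := by
      ext ω
      simp only [Set.mem_preimage, Set.mem_singleton_iff, Set.mem_ofPred_eq, Prod.mk.injEq,
        ← history_eq_iff, hrx]
    have e2 : history τ t ⁻¹' {x} = {ω | SameHistory τ t ω (r x)} := by
      ext ω
      simp only [Set.mem_preimage, Set.mem_singleton_iff, Set.mem_ofPred_eq, ← history_eq_iff, hrx]
    rw [e1, e2, measureReal_def, measureReal_def, hlaw, ENNReal.toReal_mul,
      ENNReal.toReal_ofReal (hq0 _ _)]
  · have e1 : (fun ω => (history τ t ω, τ t ω)) ⁻¹' {(x, y)} = ∅ := by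
      ext ω
      simp only [Set.mem_preimage, Set.mem_singleton_iff, Prod.mk.injEq, Set.mem_empty_iff_false,
        iff_false, not_and]
      exact fun h => (hx ⟨ω, h⟩).elim
    have e2 : history τ t ⁻¹' {x} = ∅ := by
      ext ω
      simp only [Set.mem_preimage, Set.mem_singleton_iff, Set.mem_empty_iff_false, iff_false]
      exact fun h => hx ⟨ω, h⟩
    rw [e1, e2]
    simp

end Histories

/-! ### Error recursion along a run. -/

section Run

variable {S A : Type*} [Fintype S] [Fintype A]
variable {Ω : Type*} [MeasurableSpace Ω] {P : Measure Ω}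
  {M : FiniteMDP S A} {μ : S → ℝ} {H B T : ℕ} {base : ℕ → ℝ} {lam : ℝ} {η β : ℕ → ℝ}
  {θ₁ : Param S A} {τ : ℕ → Ω → Fin B → Traj S A H} {u θ : ℕ → Ω → Param S A}

/-- The iterate `θ t` is fixed before batch `t` is drawn, whereas `u t` uses batch `t`; hence the
shifted time for `u`. -/
theorem IsStormRun.eq_of_sameHistory (h : IsStormRun P M μ H B T base lam η β θ₁ τ u θ)
    {t : ℕ} (ht : 1 ≤ t) :
    (t ≤ T → ∀ ω ω', SameHistory τ t ω ω' → θ t ω = θ t ω') ∧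
    (t < T → ∀ ω ω', SameHistory τ (t + 1) ω ω' → u t ω = u t ω') := by
  induction t, ht using Nat.le_induction with
  | base =>
    refine ⟨fun _ ω ω' _ => by rw [h.init, h.init], fun hT ω ω' hs => ?_⟩
    rw [h.est_one hT, h.est_one hT, h.init, h.init, hs 1 le_rfl (Nat.lt_succ_self 1)]
  | succ t ht ih =>
    have hθ : t + 1 ≤ T → ∀ ω ω', SameHistory τ (t + 1) ω ω' → θ (t + 1) ω = θ (t + 1) ω' := by
      intro hT ω ω' hs
      rw [h.step t ht hT, h.step t ht hT, ih.1 (by omega) ω ω' (hs.mono (by omega)),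
        ih.2 hT ω ω' hs]
    refine ⟨hθ, fun hT ω ω' hs => ?_⟩
    have hs' := hs.mono (Nat.le_succ (t + 1))
    rw [h.est_succ t ht hT, h.est_succ t ht hT, hθ hT.le ω ω' hs',
      ih.1 (by omega) ω ω' (hs'.mono (by omega)), ih.2 (by omega) ω ω' hs',
      hs (t + 1) (by omega) (by omega)]

theorem IsStormRun.integrable_comp_param [IsProbabilityMeasure P]
    (h : IsStormRun P M μ H B T base lam η β θ₁ τ u θ) {t : ℕ} (ht : 1 ≤ t) (htT : t ≤ T)
    (f : Param S A → ℝ) : Integrable (fun ω => f (θ t ω)) P := by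
  classical
  exact integrable_of_sameHistory P htT h.measurable_batch fun ω ω' hs => by
    rw [(h.eq_of_sameHistory ht).1 htT ω ω' hs]

theorem IsStormRun.integrable_comp_est [IsProbabilityMeasure P]
    (h : IsStormRun P M μ H B T base lam η β θ₁ τ u θ) {t : ℕ} (ht : 1 ≤ t) (htT : t < T)
    (f : Param S A → Param S A → ℝ) : Integrable (fun ω => f (u t ω) (θ t ω)) P := by
  classical
  exact integrable_of_sameHistory P (t := t + 1) htT h.measurable_batch fun ω ω' hs => by
    rw [(h.eq_of_sameHistory ht).2 htT ω ω' hs,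
      (h.eq_of_sameHistory ht).1 htT.le ω ω' (hs.mono (Nat.le_succ t))]

theorem IsStormRun.integral_batch [IsProbabilityMeasure P] (hμ : μ ∈ stdSimplex ℝ S)
    (h : IsStormRun P M μ H B T base lam η β θ₁ τ u θ) {t : ℕ} (ht : 1 ≤ t) (htT : t < T)
    {F : Ω → (Fin B → Traj S A H) → ℝ} (hF : ∀ ω ω', SameHistory τ t ω ω' → F ω = F ω') :
    ∫ ω, F ω (τ t ω) ∂P = ∫ ω, ∑ y, (∏ i, trajProb M μ (θ t ω) (y i)) * F ω y ∂P := by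
  classical
  refine integral_batch_eq P ht htT h.measurable_batch
    (fun ω ω' hs => by rw [(h.eq_of_sameHistory ht).1 htT.le ω ω' hs])
    (fun ω y => Finset.prod_nonneg fun i _ => trajProb_nonneg M hμ _ _) ?_ hF
  exact h.law_batch t ht htT

theorem IsStormRun.integral_error_one_le [IsProbabilityMeasure P] [Nonempty A]
    (hμ : μ ∈ stdSimplex ℝ S)
    (h : IsStormRun P M μ H B T base lam η β θ₁ τ u θ) {Mg Mh : ℝ}
    (hb : ScoreBounds S A Mg Mh) (hMg : 0 ≤ Mg)
    (hbase : ∀ h < H, ∀ s a, |M.disc ^ h * M.reward s a - base h| ≤ M.disc ^ h)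
    (hB : 1 ≤ B) (hT : 1 < T) :
    ∫ ω, ‖u 1 ω - truncGrad M μ H (θ 1 ω)‖ ^ 2 ∂P ≤ (Mg / (1 - M.disc) ^ 2) ^ 2 / B := by
  have h1 := h.integral_batch hμ le_rfl hT (F := fun _ y =>
    ‖(1 / (B : ℝ)) • ∑ i : Fin B, gpomdp M base θ₁ (y i) - truncGrad M μ H θ₁‖ ^ 2)
    (fun _ _ _ => rfl)
  simp_rw [h.est_one hT, h.init] at h1 ⊢
  rw [h1]
  simp only [integral_const, probReal_univ, one_smul]
  exact hb.batch_error_init_le hMg M hμ hbase hB θ₁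

theorem IsStormRun.integral_error_succ_le [IsProbabilityMeasure P] [Nonempty A]
    (hμ : μ ∈ stdSimplex ℝ S)
    (h : IsStormRun P M μ H B T base lam η β θ₁ τ u θ) {Mg Mh W : ℝ}
    (hb : ScoreBounds S A Mg Mh) (hMg : 0 ≤ Mg) (hMh : 0 ≤ Mh)
    (hbase : ∀ h < H, ∀ s a, |M.disc ^ h * M.reward s a - base h| ≤ M.disc ^ h)
    (hB : 1 ≤ B)
    (hW : ∀ᵐ ω ∂P, ∀ t, 1 ≤ t → t + 1 ≤ T → impWeightVar M μ H (θ t ω) (θ (t + 1) ω) ≤ W)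
    {t : ℕ} (ht : 1 ≤ t) (htT : t + 1 < T) :
    ∫ ω, ‖u (t + 1) ω - truncGrad M μ H (θ (t + 1) ω)‖ ^ 2 ∂P ≤
      (1 - β (t + 1)) ^ 2 * ∫ ω, ‖u t ω - truncGrad M μ H (θ t ω)‖ ^ 2 ∂P
      + 2 * β (t + 1) ^ 2 * (Mg / (1 - M.disc) ^ 2) ^ 2 / B
      + 4 * (1 - β (t + 1)) ^ 2 * ((Mh / (1 - M.disc) ^ 2) ^ 2
          + (Mg / (1 - M.disc) ^ 2) ^ 2 * (H * (2 * H * Mg ^ 2 + Mh) * (W + 1))) * η t ^ 2 / B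
        * ∫ ω, ‖u t ω + barrierGrad lam (θ t ω)‖ ^ 2 ∂P := by
  have hB0 : (0 : ℝ) < B := by exact_mod_cast hB
  have hts : 1 ≤ t + 1 := by omega
  have h1 := h.integral_batch hμ hts htT (F := fun ω y =>
    ‖(β (t + 1) / (B : ℝ)) • ∑ i : Fin B, gpomdp M base (θ (t + 1) ω) (y i)
      + (1 - β (t + 1)) • (u t ω + (1 / (B : ℝ)) • ∑ i : Fin B,
          (gpomdp M base (θ (t + 1) ω) (y i)
            - impWeight (θ t ω) (θ (t + 1) ω) (y i) • gpomdp M base (θ t ω) (y i)))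
      - truncGrad M μ H (θ (t + 1) ω)‖ ^ 2)
    (fun ω ω' hs => by
      simp only [(h.eq_of_sameHistory hts).1 htT.le ω ω' hs,
        (h.eq_of_sameHistory ht).1 (by omega) ω ω' (hs.mono (Nat.le_succ t)),
        (h.eq_of_sameHistory ht).2 (by omega) ω ω' hs])
  simp_rw [h.est_succ t ht htT]
  rw [h1]
  set Lg := Mh / (1 - M.disc) ^ 2
  set G := Mg / (1 - M.disc) ^ 2
  set C := (H : ℝ) * (2 * H * Mg ^ 2 + Mh) * (W + 1)
  have hI1 := h.integrable_comp_est ht (by omega) fun u θ => ‖u - truncGrad M μ H θ‖ ^ 2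
  have hI2 := h.integrable_comp_est ht (by omega) fun u θ => ‖u + barrierGrad lam θ‖ ^ 2
  rw [← integral_const_mul, ← integral_const_mul]
  have e : ∀ c : ℝ, c = ∫ _ω, c ∂P := fun c => by simp
  have hI3 : Integrable (fun ω => (1 - β (t + 1)) ^ 2 * ‖u t ω - truncGrad M μ H (θ t ω)‖ ^ 2
      + 2 * β (t + 1) ^ 2 * G ^ 2 / B) P := (hI1.const_mul _).add (integrable_const _)
  rw [e (2 * β (t + 1) ^ 2 * G ^ 2 / B), ← integral_add (hI1.const_mul _) (integrable_const _),
    ← integral_add hI3 (hI2.const_mul _)]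
  refine integral_mono_ae ?_ (hI3.add (hI2.const_mul _)) ?_
  · refine integrable_of_sameHistory P htT.le h.measurable_batch fun ω ω' hs => ?_
    simp only [(h.eq_of_sameHistory hts).1 htT.le ω ω' hs,
        (h.eq_of_sameHistory ht).1 (by omega) ω ω' (hs.mono (Nat.le_succ t)),
        (h.eq_of_sameHistory ht).2 (by omega) ω ω' hs]
  · filter_upwards [hW] with ω hω
    refine (hb.batch_error_succ_le hMg hMh M hμ hbase hB (β (t + 1)) (θ t ω) (θ (t + 1) ω)
      (u t ω)).trans ?_
    have hV := hb.impWeightVar_le hMh M hμ H _ _ (hω t ht htT.le)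
    -- Both correction errors are quadratic in the displacement, which is the step size times the
    -- update direction.
    have hd : ‖θ (t + 1) ω - θ t ω‖ ^ 2 = η t ^ 2 * ‖u t ω + barrierGrad lam (θ t ω)‖ ^ 2 := by
      rw [h.step t ht (by omega), add_sub_cancel_left, norm_smul, mul_pow, Real.norm_eq_abs, sq_abs]
    rw [norm_sub_rev, hd] at hV
    refine add_le_add le_rfl ?_
    rw [hd]
    have h2 := mul_le_mul_of_nonneg_left hV (sq_nonneg G)
    have h3 := mul_le_mul_of_nonneg_left h2
      (show 0 ≤ 4 * (1 - β (t + 1)) ^ 2 / (B : ℝ) by positivity)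
    refine le_trans (le_of_eq ?_) ((add_le_add (le_refl (4 * (1 - β (t + 1)) ^ 2 / (B : ℝ) *
      (Lg ^ 2 * (η t ^ 2 * ‖u t ω + barrierGrad lam (θ t ω)‖ ^ 2)))) h3).trans_eq ?_)
    · ring
    · ring

end Run

/-! ### Step-size inequalities. -/

section StepSizes

theorem sum_one_div_add_le_log {m : ℝ} (hm : 2 ≤ m) {t : ℕ} (ht : 1 ≤ t) :
    ∑ i ∈ Finset.Ico 1 t, 1 / (m + i) ≤ Real.log (t + 1) := by
  induction t, ht using Nat.le_induction with
  | base => simpa using Real.log_nonneg (by norm_num)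
  | succ t ht ih =>
    rw [Finset.sum_Ico_succ_top ht]
    have ht0 : (0 : ℝ) ≤ t := Nat.cast_nonneg t
    have h1 : 1 / (m + t) ≤ 1 / ((t : ℝ) + 2) :=
      one_div_le_one_div_of_le (by linarith) (by linarith)
    have h2 := Real.one_sub_inv_le_log_of_pos (show (0 : ℝ) < (t + 2) / (t + 1) by positivity)
    rw [Real.log_div (by positivity) (by positivity), inv_div] at h2
    have h3 : 1 - ((t : ℝ) + 1) / (t + 2) = 1 / (t + 2) := by field_simp; ring
    push_cast
    rw [add_assoc (t : ℝ), one_add_one_eq_two]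
    linarith

/-- The properties of the step sizes `k / (m + t) ^ (1 / 3)` used in the analysis. -/
theorem stepSize_facts {k Ll c m b2 : ℝ} (hk : 0 < k) (hLl : 0 < Ll) (hb2 : 0 < b2)
    (hc : c = 1 / (3 * k ^ 3 * Ll) + 96 * b2)
    (hm : m = max 2 (max ((2 * Ll * k) ^ 3) ((c * k / (2 * Ll)) ^ 3)))
    {η : ℕ → ℝ} (hη : ∀ t, η t = k / (m + t) ^ (1 / 3 : ℝ)) :
    (∀ t, 0 < η t) ∧ (∀ t, η t ≤ 1 / (2 * Ll)) ∧ (∀ t, η (t + 1) ≤ η t) ∧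
    (∀ t, c * η t ^ 2 ≤ 1) ∧
    (∀ t, 1 / η (t + 1) - 1 / η t ≤ η (t + 1) * (c - 96 * b2)) ∧
    (∀ t, η t ^ 3 = k ^ 3 * (1 / (m + t))) := by
  have hm2 : 2 ≤ m := hm ▸ le_max_left _ _
  have hm3 : (2 * Ll * k) ^ 3 ≤ m := hm ▸ (le_max_left _ _).trans (le_max_right _ _)
  have hm4 : (c * k / (2 * Ll)) ^ 3 ≤ m := hm ▸ (le_max_right _ _).trans (le_max_right _ _)
  have hc0 : 0 < c := by rw [hc]; positivity
  obtain ⟨x, hx⟩ : ∃ x : ℕ → ℝ, ∀ t : ℕ, x t = (m + t) ^ (1 / 3 : ℝ) := ⟨_, fun _ => rfl⟩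
  have hmt : ∀ t : ℕ, m ≤ m + t := fun t => by linarith [(Nat.cast_nonneg t : (0 : ℝ) ≤ t)]
  have hx0 : ∀ t, 0 < x t := fun t => by
    rw [hx]; exact Real.rpow_pos_of_pos (by linarith [hmt t]) _
  have hx3 : ∀ t, x t ^ 3 = m + t := fun t => by
    rw [hx, ← Real.rpow_natCast, ← Real.rpow_mul (by linarith [hmt t])]
    norm_num
  have hηx : ∀ t, η t = k / x t := fun t => by rw [hη, hx]
  have hxL : ∀ t, 2 * Ll * k ≤ x t := fun t =>
    le_of_pow_le_pow_left₀ three_ne_zero (hx0 t).le (by rw [hx3]; exact hm3.trans (hmt t))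
  have hxc : ∀ t, c * k / (2 * Ll) ≤ x t := fun t =>
    le_of_pow_le_pow_left₀ three_ne_zero (hx0 t).le (by rw [hx3]; exact hm4.trans (hmt t))
  have hxs : ∀ t, x (t + 1) ^ 3 = x t ^ 3 + 1 := fun t => by
    rw [hx3, hx3]; push_cast; ring
  have hxle : ∀ t, x t ≤ x (t + 1) := fun t =>
    le_of_pow_le_pow_left₀ three_ne_zero (hx0 _).le (by rw [hxs]; linarith)
  refine ⟨fun t => ?_, fun t => ?_, fun t => ?_, fun t => ?_, fun t => ?_, fun t => ?_⟩
  · rw [hηx]; exact div_pos hk (hx0 t)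
  · rw [hηx, div_le_div_iff₀ (hx0 t) (by positivity)]
    linarith [hxL t]
  · rw [hηx, hηx]
    exact div_le_div_of_nonneg_left hk.le (hx0 t) (hxle t)
  · rw [hηx, div_pow, mul_div_assoc', div_le_one (by have := hx0 t; positivity)]
    -- The last two entries of the maximum defining `m` multiply to exactly `c * k ^ 2 ≤ x t ^ 2`.
    have h1 := mul_le_mul (hxL t) (hxc t) (by positivity) (hx0 t).le
    have h2 : 2 * Ll * k * (c * k / (2 * Ll)) = c * k ^ 2 := by field_simp
    rw [h2] at h1
    linarith
  · have hy := hx0 t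
    have hz := hx0 (t + 1)
    rw [hηx, hηx, one_div_div, one_div_div, hc, add_sub_cancel_right, ← sub_div]
    -- From `x t ^ 3 + 1 ≤ 8 * x t ^ 3`, as `m ≥ 2`. With `2 * Ll * k ≤ x t` it turns the increment
    -- bound `1 / (3 * x t ^ 2)` of the cube root into one proportional to `η (t + 1)`.
    have h2y : x (t + 1) ≤ 2 * x t := by
      refine le_of_pow_le_pow_left₀ three_ne_zero (by positivity) ?_
      rw [mul_pow, hxs]
      have := hx3 t
      linarith [hmt t]
    have h1 : k * Ll * x (t + 1) ≤ x t ^ 2 := by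
      have := mul_le_mul_of_nonneg_right (hxL t) hy.le
      have := mul_le_mul_of_nonneg_left h2y (show 0 ≤ k * Ll by positivity)
      nlinarith
    have h2 : (x (t + 1) - x t) * (3 * x t ^ 2) ≤ 1 := by
      have h3 : (x (t + 1) - x t) * (x (t + 1) ^ 2 + x (t + 1) * x t + x t ^ 2) = 1 := by
        linear_combination hxs t
      rw [← h3]
      refine mul_le_mul_of_nonneg_left ?_ (sub_nonneg.2 (hxle t))
      nlinarith [hxle t]
    have h3 : (x (t + 1) - x t) * (3 * (k * Ll * x (t + 1))) ≤ 1 :=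
      (mul_le_mul_of_nonneg_left (by linarith) (sub_nonneg.2 (hxle t))).trans h2
    have h4 : k / x (t + 1) * (1 / (3 * k ^ 3 * Ll)) = 1 / (3 * (k * Ll * x (t + 1))) / k := by
      field_simp
    rw [h4]
    refine div_le_div_of_nonneg_right ?_ hk.le
    rwa [le_div_iff₀ (by positivity)]
  · rw [hηx, div_pow, hx3, mul_one_div]

end StepSizes

/-! ### Summing the error potential and the ascent inequality. -/

section Recursion

/-- Summation of the potential `E t / η (t - 1)` of the estimation error. -/
theorem sum_error_le {E D η β : ℕ → ℝ} {T B : ℕ} {c s b2 : ℝ} (hb2 : 0 < b2) (hT : 1 < T)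
    (hE : ∀ t, 0 ≤ E t) (hD : ∀ t, 0 ≤ D t) (hη0 : ∀ t, 0 < η t) (hηa : ∀ t, η (t + 1) ≤ η t)
    (hc0 : 96 * b2 ≤ c) (hs : 0 ≤ s)
    (hcη : ∀ t, c * η t ^ 2 ≤ 1)
    (hηd : ∀ t, 1 / η (t + 1) - 1 / η t ≤ η (t + 1) * (c - 96 * b2))
    (hβ : ∀ t, 1 ≤ t → β (t + 1) = c * η t ^ 2)
    (h1 : E 1 ≤ s / B)
    (h2 : ∀ t, 1 ≤ t → t + 1 < T → E (t + 1) ≤ (1 - β (t + 1)) ^ 2 * E t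
      + 2 * β (t + 1) ^ 2 * s / B + 4 * (1 - β (t + 1)) ^ 2 * b2 * η t ^ 2 / B * D t) :
    96 * b2 * ∑ i ∈ Finset.Ico 1 T, η i * E i ≤ s / B / η 0
      + 2 * c ^ 2 * s / B * ∑ i ∈ Finset.Ico 1 T, η i ^ 3
      + 4 * b2 / B * ∑ i ∈ Finset.Ico 1 T, η i * D i := by
  have hcpos : 0 ≤ c := (by positivity : (0 : ℝ) ≤ 96 * b2).trans hc0
  have key : ∀ t, t + 1 < T → 96 * b2 * ∑ i ∈ Finset.Ico 1 (t + 1), η i * E i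
      + E (t + 1) / η t ≤ s / B / η 0
      + 2 * c ^ 2 * s / B * ∑ i ∈ Finset.Ico 1 (t + 1), η i ^ 3
      + 4 * b2 / B * ∑ i ∈ Finset.Ico 1 (t + 1), η i * D i := by
    intro t
    induction t with
    | zero =>
      intro _
      -- The potential at time `1` divides by `η 0`, the source of the term `m ^ (1 / 3) / k`.
      simpa using div_le_div_of_nonneg_right h1 (hη0 0).le
    | succ t ih =>
      intro ht
      have ih := ih (by omega)
      have ht1 : 1 ≤ t + 1 := by omega
      rw [Finset.sum_Ico_succ_top ht1 (fun i => η i * E i),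
        Finset.sum_Ico_succ_top ht1 (fun i => η i ^ 3),
        Finset.sum_Ico_succ_top ht1 (fun i => η i * D i)]
      have hrec := h2 (t + 1) (by omega) ht
      rw [hβ (t + 1) (by omega)] at hrec
      set e := η (t + 1) with he
      have he0 : 0 < e := hη0 _
      have hce := hcη (t + 1)
      rw [← he] at hce
      have hβ0 : 0 ≤ c * e ^ 2 := by positivity
      have hsq : (1 - c * e ^ 2) ^ 2 ≤ 1 - c * e ^ 2 := by nlinarith
      have hEt := hE (t + 1)
      have hDt := hD (t + 1)
      have a1 : (1 - c * e ^ 2) ^ 2 * E (t + 1) ≤ (1 - c * e ^ 2) * E (t + 1) :=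
        mul_le_mul_of_nonneg_right hsq hEt
      have a2 : 4 * (1 - c * e ^ 2) ^ 2 * b2 * e ^ 2 / B * D (t + 1) ≤
          4 * b2 / B * e ^ 2 * D (t + 1) := by
        have h' : (1 - c * e ^ 2) ^ 2 ≤ 1 := by linarith
        have := mul_le_mul_of_nonneg_right h' (show 0 ≤ 4 * b2 / B * e ^ 2 * D (t + 1) by positivity)
        refine le_trans (le_of_eq ?_) (this.trans_eq (one_mul _))
        ring
      have a3 : E (t + 1 + 1) / e ≤ (1 / e - c * e) * E (t + 1) + 2 * c ^ 2 * s / B * e ^ 3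
          + 4 * b2 / B * (e * D (t + 1)) := by
        rw [div_le_iff₀ he0]
        refine (hrec.trans (add_le_add (add_le_add a1 le_rfl) a2)).trans_eq ?_
        field_simp
      -- Here the choice of `c` acts: its part beyond `96 * b2` pays for the growth of `1 / η`.
      have a4 : (1 / e - c * e) * E (t + 1) ≤ (1 / η t - 96 * b2 * e) * E (t + 1) := by
        refine mul_le_mul_of_nonneg_right ?_ hEt
        have := hηd t
        rw [← he] at this
        linarith
      have a5 : 1 / η t * E (t + 1) = E (t + 1) / η t := by ring
      rw [sub_mul (1 / η t), a5] at a4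
      rw [mul_add (96 * b2), mul_add (2 * c ^ 2 * s / B), mul_add (4 * b2 / B)]
      linarith
  obtain ⟨t, rfl⟩ : ∃ t, T = t + 2 := ⟨T - 2, by omega⟩
  have hk := key t (by omega)
  have ht1 : 1 ≤ t + 1 := by omega
  rw [Finset.sum_Ico_succ_top ht1 (fun i => η i * E i),
    Finset.sum_Ico_succ_top ht1 (fun i => η i ^ 3),
    Finset.sum_Ico_succ_top ht1 (fun i => η i * D i)]
  rw [mul_add (96 * b2), mul_add (2 * c ^ 2 * s / B), mul_add (4 * b2 / B)]
  -- The recursion stops at `T - 1`, so the last error is read off from the remaining potential.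
  have b1 : 96 * b2 * (η (t + 1) * E (t + 1)) ≤ E (t + 1) / η t := by
    rw [le_div_iff₀ (hη0 t)]
    have h3 : η (t + 1) * η t ≤ η t ^ 2 := by
      rw [pow_two]; exact mul_le_mul_of_nonneg_right (hηa t) (hη0 t).le
    have h4 : 96 * b2 * (η (t + 1) * η t) ≤ 1 :=
      (mul_le_mul hc0 h3 (mul_pos (hη0 _) (hη0 _)).le hcpos).trans (hcη t)
    have := mul_le_mul_of_nonneg_right h4 (hE (t + 1))
    linarith
  have b2' : 0 ≤ 2 * c ^ 2 * s / B * η (t + 1) ^ 3 := by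
    have := hη0 (t + 1)
    positivity
  have b3 : 0 ≤ 4 * b2 / B * (η (t + 1) * D (t + 1)) := by
    have := hη0 (t + 1)
    have := hD (t + 1)
    positivity
  linarith

/-- The gradient sum is controlled by the ascent inequality and the error potential. -/
theorem sum_gradient_le {E D N Φ η β : ℕ → ℝ} {T B : ℕ} {c s b2 Φs : ℝ} (hB : 1 ≤ B)
    (hb2 : 0 < b2) (hT : 1 ≤ T)
    (hE : ∀ t, 0 ≤ E t) (hD : ∀ t, 0 ≤ D t) (hη0 : ∀ t, 0 < η t) (hηa : ∀ t, η (t + 1) ≤ η t)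
    (hc0 : 96 * b2 ≤ c) (hs : 0 ≤ s)
    (hcη : ∀ t, c * η t ^ 2 ≤ 1)
    (hηd : ∀ t, 1 / η (t + 1) - 1 / η t ≤ η (t + 1) * (c - 96 * b2))
    (hβ : ∀ t, 1 ≤ t → β (t + 1) = c * η t ^ 2)
    (h1 : 1 < T → E 1 ≤ s / B)
    (h2 : ∀ t, 1 ≤ t → t + 1 < T → E (t + 1) ≤ (1 - β (t + 1)) ^ 2 * E t
      + 2 * β (t + 1) ^ 2 * s / B + 4 * (1 - β (t + 1)) ^ 2 * b2 * η t ^ 2 / B * D t)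
    (h3 : ∀ t, 1 ≤ t → t < T →
      Φ t + η t / 2 * N t - η t / 2 * E t + η t / 4 * D t ≤ Φ (t + 1))
    (h4 : Φ T + η T / 2 * N T ≤ Φs) :
    ∑ t ∈ Finset.Icc 1 T, η t * N t ≤ 2 * (Φs - Φ 1) +
      (s / η 0 / (96 * b2) + c ^ 2 * s / (48 * b2) * ∑ i ∈ Finset.Ico 1 T, η i ^ 3) / B := by
  have hB0 : (1 : ℝ) ≤ B := by exact_mod_cast hB
  have htel : ∀ t, 1 ≤ t → t ≤ T → Φ 1 + (∑ i ∈ Finset.Ico 1 t, η i * N i) / 2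
      - (∑ i ∈ Finset.Ico 1 t, η i * E i) / 2 + (∑ i ∈ Finset.Ico 1 t, η i * D i) / 4 ≤ Φ t := by
    intro t ht
    induction t, ht using Nat.le_induction with
    | base => intro _; simp
    | succ t ht ih =>
      intro htT
      have := ih (by omega)
      have := h3 t ht htT
      rw [Finset.sum_Ico_succ_top ht, Finset.sum_Ico_succ_top ht, Finset.sum_Ico_succ_top ht]
      linarith
  have ht := htel T hT le_rfl
  rw [← Finset.Ico_insert_right hT, Finset.sum_insert Finset.right_notMem_Ico]
  have hDs : 0 ≤ ∑ i ∈ Finset.Ico 1 T, η i * D i :=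
    Finset.sum_nonneg fun i _ => mul_nonneg (hη0 i).le (hD i)
  have hη3 : 0 ≤ ∑ i ∈ Finset.Ico 1 T, η i ^ 3 :=
    Finset.sum_nonneg fun i _ => pow_nonneg (hη0 i).le 3
  -- The factor `1 / 24` is `4 * b2 / (96 * b2)`, with `1 / B ≤ 1`. Half of it is below the surplus
  -- coefficient `1 / 4` in `htel`.
  have herr : ∑ i ∈ Finset.Ico 1 T, η i * E i ≤
      (s / η 0 / (96 * b2) + c ^ 2 * s / (48 * b2) * ∑ i ∈ Finset.Ico 1 T, η i ^ 3) / B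
      + (∑ i ∈ Finset.Ico 1 T, η i * D i) / 24 := by
    rcases hT.eq_or_lt with h | h
    · subst h
      have := hη0 0
      simp only [Finset.Ico_self, Finset.sum_empty, mul_zero, add_zero, zero_div]
      positivity
    · have he := sum_error_le hb2 h hE hD hη0 hηa hc0 hs hcη hηd hβ (h1 h) h2
      have hd : 4 * b2 / B * ∑ i ∈ Finset.Ico 1 T, η i * D i ≤
          4 * b2 * ∑ i ∈ Finset.Ico 1 T, η i * D i :=
        mul_le_mul_of_nonneg_right (div_le_self (by positivity) hB0) hDs
      have he' := (le_div_iff₀' (show (0 : ℝ) < 96 * b2 by positivity)).2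
        (he.trans (add_le_add le_rfl hd))
      refine he'.trans_eq ?_
      have := (hη0 0).ne'
      field_simp
      ring
  linarith

end Recursion

/-! ### The one-step ascent inequality. -/

section Ascent

variable {S A : Type*} [Fintype S] [Fintype A]

/-- Polarization rewrites the inner product of gradient and direction through their squared norms
and the squared error. The smoothness loss eats at most half of the direction term since `Ll * e ≤ 1
/ 2`. -/
theorem ScoreBounds.regValue_step_lower {Mg Mh : ℝ} [Nonempty A] [Nonempty S]
    (hb : ScoreBounds S A Mg Mh)
    (hMh : 0 ≤ Mh) (M : FiniteMDP S A) {μ : S → ℝ} (hμ : μ ∈ stdSimplex ℝ S) (H : ℕ)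
    {lam Ll e : ℝ} (hlam : 0 ≤ lam)
    (hLl : Ll = 2 * Mg ^ 2 / (1 - M.disc) ^ 3 + Mh / (1 - M.disc) ^ 2 + lam) (hLl0 : 0 < Ll)
    (he0 : 0 < e) (he : e ≤ 1 / (2 * Ll)) (θ u : Param S A) :
    regValue M μ H lam θ + e / 2 * ‖regGrad M μ H lam θ‖ ^ 2
      - e / 2 * ‖u - truncGrad M μ H θ‖ ^ 2 + e / 4 * ‖u + barrierGrad lam θ‖ ^ 2
      ≤ regValue M μ H lam (θ + e • (u + barrierGrad lam θ)) := by
  have h := hb.regValue_lower hMh M hμ H hlam θ (e • (u + barrierGrad lam θ))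
  rw [← hLl] at h
  refine le_trans ?_ h
  set d := u + barrierGrad lam θ
  have h1 : u - truncGrad M μ H θ = d - regGrad M μ H lam θ := by
    simp only [d, regGrad]; abel
  rw [h1, norm_sub_sq_real, norm_smul, real_inner_smul_right, mul_pow, Real.norm_eq_abs, sq_abs,
    real_inner_comm d]
  have h2 : Ll * e ≤ 1 / 2 := by
    rw [le_div_iff₀ (by positivity)] at he
    linarith
  have h3 : Ll / 2 * (e ^ 2 * ‖d‖ ^ 2) ≤ e / 4 * ‖d‖ ^ 2 := by
    have := mul_le_mul_of_nonneg_right h2 (show 0 ≤ e / 2 * ‖d‖ ^ 2 by positivity)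
    linarith
  linarith

end Ascent

end StormPG

/-! ### Assembly of the convergence bound. -/

theorem mainTheorem5 {S A : Type*} [Fintype S] [Nonempty S] [Fintype A] [Nonempty A]
    (M : FiniteMDP S A) (μ : S → ℝ) (hμ : μ ∈ stdSimplex ℝ S)
    (H : ℕ) (lam : ℝ) (hlam : 0 < lam) :
    ScoreBounds S A 2 1 ∧
    (∃ θs : Param S A, ∀ θ, regValue M μ H lam θ ≤ regValue M μ H lam θs) ∧
    ∀ (Mg Mh : ℝ), 0 < Mg → 0 < Mh → ScoreBounds S A Mg Mh →
    ∀ (B T : ℕ), 1 ≤ B →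
    ∀ (base : ℕ → ℝ),
      (∀ h < H, ∀ s a, |M.disc ^ h * M.reward s a - base h| ≤ M.disc ^ h) →
    ∀ (k W : ℝ), 0 < k → 0 < W →
    ∀ (Lg G σ L Llam Cw b c m : ℝ),
      Lg = Mh / (1 - M.disc) ^ 2 →
      G = Mg / (1 - M.disc) ^ 2 →
      σ = G →
      L = 2 * Mg ^ 2 / (1 - M.disc) ^ 3 + Mh / (1 - M.disc) ^ 2 →
      Llam = L + lam →
      Cw = Real.sqrt ((H : ℝ) * (2 * H * Mg ^ 2 + Mh) * (W + 1)) →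
      b ^ 2 = Lg ^ 2 + G ^ 2 * Cw ^ 2 →
      c = 1 / (3 * k ^ 3 * Llam) + 96 * b ^ 2 →
      m = max 2 (max ((2 * Llam * k) ^ 3) ((c * k / (2 * Llam)) ^ 3)) →
    ∀ (η β : ℕ → ℝ),
      (∀ t, η t = k / (m + t) ^ (1 / 3 : ℝ)) →
      (∀ t, 1 ≤ t → β (t + 1) = c * η t ^ 2) →
    ∀ {Ω : Type*} [MeasurableSpace Ω] (P : Measure Ω) [IsProbabilityMeasure P]
      (θ₁ : Param S A) (τ : ℕ → Ω → Fin B → Traj S A H) (u θ : ℕ → Ω → Param S A),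
      IsStormRun P M μ H B T base lam η β θ₁ τ u θ →
      (∀ᵐ ω ∂P, ∀ t, 1 ≤ t → t + 1 ≤ T →
        impWeightVar M μ H (θ t ω) (θ (t + 1) ω) ≤ W) →
    ∀ (θs : Param S A), (∀ θ', regValue M μ H lam θ' ≤ regValue M μ H lam θs) →
    ∀ (Γ₁ Γ₂ Γ₃ : ℝ),
      Γ₁ = c ^ 2 * σ ^ 2 * k ^ 3 * Real.log (T + 2) / (44 * b ^ 2)
          + m ^ (1 / 3 : ℝ) * σ ^ 2 / (88 * b ^ 2 * k)
          + 1 / 22 * (regValue M μ H lam θs - regValue M μ H lam θ₁) →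
      Γ₂ = 48 / 11 * (regValue M μ H lam θs - regValue M μ H lam θ₁) →
      Γ₃ = σ ^ 2 * m ^ (1 / 3 : ℝ) / (44 * b ^ 2 * k)
          + c ^ 2 * σ ^ 2 * k ^ 3 / (22 * b ^ 2) * Real.log (2 + T) →
      (∀ t ∈ Finset.Icc 1 T,
        Integrable (fun ω => η t * ‖gradient (regValue M μ H lam) (θ t ω)‖ ^ 2) P) ∧
      ∑ t ∈ Finset.Icc 1 T,
          ∫ ω, η t * ‖gradient (regValue M μ H lam) (θ t ω)‖ ^ 2 ∂P
        ≤ Γ₂ + (Γ₁ + Γ₃) / B := by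
  refine ⟨scoreBounds_two_one S A, exists_forall_regValue_le M hμ H hlam, ?_⟩
  intro Mg Mh hMg hMh hb B T hB base hbase k W hk hW Lg G σ L Llam Cw b c m hLg hG hσ hL hLlam
    hCw hb2 hc hm η β hη hβ Ω _ P _ θ₁ τ u θ hrun hvar θs hθs Γ₁ Γ₂ Γ₃ hΓ₁ hΓ₂ hΓ₃
  have hγ : 0 < 1 - M.disc := by linarith [M.disc_mem.2]
  have hB0 : (0 : ℝ) < B := by exact_mod_cast hB
  have hLg0 : 0 < Lg := hLg ▸ by positivity
  have hb20 : 0 < b ^ 2 := by rw [hb2]; positivity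
  have hL0 : 0 < Llam := by rw [hLlam, hL]; positivity
  have hCw2 : Cw ^ 2 = H * (2 * H * Mg ^ 2 + Mh) * (W + 1) := by
    rw [hCw, Real.sq_sqrt (by positivity)]
  obtain ⟨hη0, hηL, hηa, hcη, hηd, hη3⟩ := stepSize_facts hk hL0 hb20 hc hm hη
  have hm2 : 2 ≤ m := hm ▸ le_max_left _ _
  have hint : ∀ t ∈ Finset.Icc 1 T,
      Integrable (fun ω => η t * ‖gradient (regValue M μ H lam) (θ t ω)‖ ^ 2) P := fun t ht =>
    hrun.integrable_comp_param (Finset.mem_Icc.1 ht).1 (Finset.mem_Icc.1 ht).2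
      fun θ => η t * ‖gradient (regValue M μ H lam) θ‖ ^ 2
  refine ⟨hint, ?_⟩
  have hΔ : 0 ≤ regValue M μ H lam θs - regValue M μ H lam θ₁ := sub_nonneg.2 (hθs _)
  have hlog : 0 ≤ Real.log ((T : ℝ) + 2) :=
    Real.log_nonneg (by linarith [(Nat.cast_nonneg T : (0 : ℝ) ≤ T)])
  have hlog' : Real.log (2 + (T : ℝ)) = Real.log ((T : ℝ) + 2) := by rw [add_comm]
  have hmr : 0 ≤ m ^ (1 / 3 : ℝ) := Real.rpow_nonneg (by linarith) _
  rcases Nat.eq_zero_or_pos T with hT0 | hT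
  · rw [Finset.Icc_eq_empty (by omega), Finset.sum_empty, hΓ₁, hΓ₂, hΓ₃, hlog']
    positivity
  have hLdef : Llam = 2 * Mg ^ 2 / (1 - M.disc) ^ 3 + Mh / (1 - M.disc) ^ 2 + lam := by
    rw [hLlam, hL]
  have hmain := sum_gradient_le (E := fun t => ∫ ω, ‖u t ω - truncGrad M μ H (θ t ω)‖ ^ 2 ∂P)
    (D := fun t => ∫ ω, ‖u t ω + barrierGrad lam (θ t ω)‖ ^ 2 ∂P)
    (N := fun t => ∫ ω, ‖regGrad M μ H lam (θ t ω)‖ ^ 2 ∂P)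
    (Φ := fun t => ∫ ω, regValue M μ H lam (θ t ω) ∂P)
    (Φs := regValue M μ H lam θs) (s := σ ^ 2) (c := c) hB hb20 hT
    (fun t => integral_nonneg fun ω => sq_nonneg _)
    (fun t => integral_nonneg fun ω => sq_nonneg _) hη0 hηa
    (by rw [hc]; exact le_add_of_nonneg_left (by positivity)) (sq_nonneg _) hcη hηd hβ
    (fun h1T => by
      rw [hσ, hG]
      exact hrun.integral_error_one_le hμ hb hMg.le hbase hB h1T)
    (fun t ht htT => by
      rw [hb2, hσ, hCw2, hLg, hG]
      exact hrun.integral_error_succ_le hμ hb hMg.le hMh.le hbase hB hvar ht htT)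
    (fun t ht htT => by
      have i1 := hrun.integrable_comp_param ht htT.le (regValue M μ H lam)
      have i2 := hrun.integrable_comp_param ht htT.le fun θ =>
        η t / 2 * ‖regGrad M μ H lam θ‖ ^ 2
      have i3 := hrun.integrable_comp_est ht htT fun u θ =>
        η t / 2 * ‖u - truncGrad M μ H θ‖ ^ 2
      have i4 := hrun.integrable_comp_est ht htT fun u θ =>
        η t / 4 * ‖u + barrierGrad lam θ‖ ^ 2
      have i5 := hrun.integrable_comp_param (t := t + 1) (by omega) htT (regValue M μ H lam)
      have i12 := hrun.integrable_comp_param ht htT.le fun θ =>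
        regValue M μ H lam θ + η t / 2 * ‖regGrad M μ H lam θ‖ ^ 2
      have i123 := hrun.integrable_comp_est ht htT fun u θ =>
        regValue M μ H lam θ + η t / 2 * ‖regGrad M μ H lam θ‖ ^ 2
          - η t / 2 * ‖u - truncGrad M μ H θ‖ ^ 2
      rw [← integral_const_mul, ← integral_const_mul, ← integral_const_mul, ← integral_add i1 i2,
        ← integral_sub i12 i3, ← integral_add i123 i4]
      refine integral_mono (i123.add i4) i5 fun ω => ?_
      have := hb.regValue_step_lower hMh.le M hμ H hlam.le hLdef hL0 (hη0 t) (hηL t) (θ t ω)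
        (u t ω)
      rwa [← hrun.step t ht htT ω] at this)
    (by
      have i1 := hrun.integrable_comp_param hT le_rfl (regValue M μ H lam)
      have i2 := hrun.integrable_comp_param hT le_rfl fun θ =>
        η T / 2 * ‖regGrad M μ H lam θ‖ ^ 2
      rw [← integral_const_mul, ← integral_add i1 i2]
      have hcst : regValue M μ H lam θs = ∫ _ω, regValue M μ H lam θs ∂P := by simp
      rw [hcst]
      refine integral_mono (i1.add i2) (integrable_const _) fun ω => ?_
      -- No batch is drawn at time `T`; a virtual step with the exact gradient, compared with the
      -- maximum, bounds the last summand.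
      have h := hb.regValue_step_lower hMh.le M hμ H hlam.le hLdef hL0 (hη0 T) (hηL T) (θ T ω)
        (truncGrad M μ H (θ T ω))
      rw [sub_self, norm_zero] at h
      have h' := h.trans (hθs _)
      have h'' : 0 ≤ η T / 4 * ‖truncGrad M μ H (θ T ω) + barrierGrad lam (θ T ω)‖ ^ 2 := by
        have := hη0 T
        positivity
      simp only
      linarith)
  simp_rw [integral_const_mul, gradient_regValue]
  refine hmain.trans ?_
  have hΦ1 : ∫ ω, regValue M μ H lam (θ 1 ω) ∂P = regValue M μ H lam θ₁ := by
    simp_rw [hrun.init]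
    simp
  simp only [hΦ1]
  have hs3 : ∑ i ∈ Finset.Ico 1 T, η i ^ 3 ≤ k ^ 3 * Real.log ((T : ℝ) + 2) := by
    simp_rw [hη3, ← Finset.mul_sum]
    refine mul_le_mul_of_nonneg_left ((sum_one_div_add_le_log hm2 hT).trans ?_) (by positivity)
    exact Real.log_le_log (by positivity) (by linarith)
  have hη00 : σ ^ 2 / η 0 / (96 * b ^ 2) = m ^ (1 / 3 : ℝ) * σ ^ 2 / (96 * b ^ 2 * k) := by
    rw [hη 0, Nat.cast_zero, add_zero, div_div_eq_mul_div, div_div]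
    congr 1 <;> ring
  -- The argument yields the constants `2`, `96` and `48` in place of `48 / 11`, `88` and `44`; the
  -- `Δ` term of `Γ₁` and all of `Γ₃` are slack.
  have hfirst : 2 * (regValue M μ H lam θs - regValue M μ H lam θ₁) ≤ Γ₂ := by
    rw [hΓ₂]; linarith
  refine add_le_add hfirst (div_le_div_of_nonneg_right ?_ hB0.le)
  have hA : m ^ (1 / 3 : ℝ) * σ ^ 2 / (96 * b ^ 2 * k) ≤
      m ^ (1 / 3 : ℝ) * σ ^ 2 / (88 * b ^ 2 * k) :=
    div_le_div_of_nonneg_left (by positivity) (by positivity)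
      (mul_le_mul_of_nonneg_right (by linarith) hk.le)
  have hC : c ^ 2 * σ ^ 2 / (48 * b ^ 2) * ∑ i ∈ Finset.Ico 1 T, η i ^ 3 ≤
      c ^ 2 * σ ^ 2 * k ^ 3 * Real.log (T + 2) / (44 * b ^ 2) := by
    refine (mul_le_mul_of_nonneg_left hs3 (by positivity)).trans ?_
    rw [div_mul_eq_mul_div, mul_assoc (c ^ 2 * σ ^ 2) (k ^ 3)]
    exact div_le_div_of_nonneg_left (by positivity) (by positivity) (by linarith)
  have hΓ3 : 0 ≤ Γ₃ := by
    rw [hΓ₃, hlog']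
    positivity
  rw [hη00, hΓ₁]
  linarith
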